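/- Let $0<q<1$. For $a\in\mathbb{C}$ put $(a;q)_j=\prod_{i=0}^{j-1}(1-aq^i)$ for $j\ge 0$, $(a;q)_{-j}=1/(aq^{-j};q)_j$ for $j\ge 1$ (so that $1/(q;q)_j=0$ for $j<0$), and $(a;q)_\infty=\prod_{i\ge 0}(1-aq^i)$. Let $${}_1\phi_1(a;c;q,x)=\sum_{j\ge 0}\frac{(a;q)_j}{(q;q)_j(c;q)_j}(-1)^jq^{\binom j2}x^j,\qquad {}_2\phi_1(a,b;c;q,x)=\sum_{j\ge 0}\frac{(a;q)_j(b;q)_j}{(q;q)_j(c;q)_j}x^j,$$ and let Jackson's third $q$-Bessel function be $$J^{(3)}_\nu(x;q)=\frac{(q^{\nu+1};q)_\infty}{(q;q)_\infty}\Bigl(\frac x2\Bigr)^{\nu}{}_1\phi_1\Bigl(0;q^{\nu+1};q,\frac{x^2q}{4}\Bigr),$$ with the principal branch of the power. For integers $m,n$ and $\nu\in\mathbb{C}$ put $$R^{(3)}_{m,n,\nu}(x;q)=\frac{(q^{\nu+m+1};q)_\infty}{(q^{\nu-1};q)_\infty}\,q^{-\max\{m+1,0\}}\Bigl(\frac x2\Bigr)^{\min\{m+2,-m\}}P^{(3)}_{m+1,n,\nu}(x;q),$$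 $$P^{(3)}_{m,n,\nu}(x;q)=\sum_{j=0}^{\max\{|n|,|m-n|\}-1}\Bigl(\frac x2\Bigr)^{2j}q^j\Bigl(A_{m,n,\nu,j+\min\{m,0\}}-B_{m,n,\nu,j-\max\{m,0\}}\Bigr),$$ where $A_{m,n,\nu,j}=B_{m,n,\nu,j}=0$ for $j<0$ and, for $j\ge 0$, $$A_{m,n,\nu,j}=\frac{(q^\nu;q)_m(q^{\nu-1};q)_{m-j}}{(q;q)_j}\,q^{(j-m+1)(n-1)+1-n\nu}\,{}_2\phi_1\bigl(q^{-j},q^{\nu+m-j-1};q^\nu;q,q^{j-n+1}\bigr),$$ $$B_{m,n,\nu,j}=\frac{(-1)^jq^{\binom{j+1}2-j\nu}}{(q;q)_j(q^{2-\nu};q)_j}\,{}_2\phi_1\bigl(q^{-j},q^{\nu-j-1};q^{\nu+m};q,q^{j+n+1}\bigr).$$ Then the following hold. (1) For all integers $m,n$ and all $\nu$ for which the coefficients are defined, $P^{(3)}_{m,n,\nu}(x;q)$ is a polynomial in $x^2$ of degree at most $\max\{|n|,|m-n|\}-1$ (the zero polynomial if $m=n=0$). (2) Let $m,n$ be integers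 and let $\nu\in\mathbb{C}$ be such that no denominator in the identity below vanishes, i.e. $q^\nu\ne q^k$ for every integer $k\le\max\{1,\,-m-1,\,n-m-1,\,-n\}$. Then for every $x\in\mathbb{C}\setminus\{0\}$, $$q^{-\frac{(\nu+m)n}{2}}J^{(3)}_{\nu+m}(xq^{n/2};q)=R^{(3)}_{m,n,\nu}(x;q)\,J^{(3)}_\nu(x;q)-R^{(3)}_{m-1,n,\nu+1}(x;q)\,J^{(3)}_{\nu-1}(x;q).$$ (3) For $n=0$ and every integer $m\ge 1$, $R^{(3)}_{m,0,\nu}(2x;q)$ is the $q$-Lommel polynomial of Koelink and Swarttouw: if $q^\nu\ne q^k$ for every integer $k\le 1$, then for every $x\in\mathbb{C}\setminus\{0\}$, $$R^{(3)}_{m,0,\nu}(2x;q)=\sum_{j=0}^{m}x^{2j-m}\frac{(q^{j+1};q)_\infty(q^\nu;q)_\infty}{(q;q)_\infty(q^{\nu+m-j};q)_\infty}\,{}_2\phi_1\bigl(q^{-j},q^{\nu+m-j};q^\nu;q,q^{j+1}\bigr).$$ -/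

import Mathlib

noncomputable section

namespace QBessel

/-- The finite `q`-shifted factorial `(a; q)_j` for `j : ℕ`. -/
def qPochNat (a q : ℂ) (j : ℕ) : ℂ := ∏ i ∈ Finset.range j, (1 - a * q ^ i)

/-- The `q`-shifted factorial `(a; q)_j` for `j : ℤ`,
with `(a; q)_{-j} = 1 / (a q^{-j}; q)_j` for `j ≥ 1`. -/
def qPoch (a q : ℂ) : ℤ → ℂ
  | Int.ofNat j => qPochNat a q j
  | Int.negSucc j => 1 / qPochNat (a * q ^ (Int.negSucc j)) q (j + 1)

/-- The infinite `q`-shifted factorial `(a; q)_∞`. -/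
def qPochInf (a q : ℂ) : ℂ := ∏' j : ℕ, (1 - a * q ^ j)

/-- The basic hypergeometric series `₁φ₁(a; c; q, x)`. -/
def phi11 (a c q x : ℂ) : ℂ :=
  ∑' j : ℕ, qPochNat a q j / (qPochNat q q j * qPochNat c q j)
    * ((-1) ^ j * q ^ (j.choose 2)) * x ^ j

/-- The basic hypergeometric series `₂φ₁(a, b; c; q, x)`. -/
def phi21 (a b c q x : ℂ) : ℂ :=
  ∑' j : ℕ, qPochNat a q j * qPochNat b q j / (qPochNat q q j * qPochNat c q j) * x ^ j

/-- Jackson's third `q`-Bessel function `J^{(3)}_ν(x; q)` (principal branch of `(x/2)^ν`). -/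
def J3 (q : ℝ) (ν x : ℂ) : ℂ :=
  qPochInf ((q : ℂ) ^ (ν + 1)) q / qPochInf q q * (x / 2) ^ ν
    * phi11 0 ((q : ℂ) ^ (ν + 1)) q (x ^ 2 * q / 4)

/-- The coefficient `A^{(3)}_{m,n,ν,j}`; it vanishes for `j < 0` because `1 / (q; q)_j = 0` there. -/
def A3 (q : ℝ) (m n : ℤ) (ν : ℂ) (j : ℤ) : ℂ :=
  if j < 0 then 0 else
    qPoch ((q : ℂ) ^ ν) q m * qPoch ((q : ℂ) ^ (ν - 1)) q (m - j) / qPoch q q j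
      * (q : ℂ) ^ ((((j - m + 1) * (n - 1) + 1 : ℤ) : ℂ) - (n : ℂ) * ν)
      * phi21 ((q : ℂ) ^ (-j)) ((q : ℂ) ^ (ν + m - j - 1)) ((q : ℂ) ^ ν) q
          ((q : ℂ) ^ (j - n + 1))

/-- The coefficient `B^{(3)}_{m,n,ν,j}`; it vanishes for `j < 0` because `1 / (q; q)_j = 0` there. -/
def B3 (q : ℝ) (m n : ℤ) (ν : ℂ) (j : ℤ) : ℂ :=
  if j < 0 then 0 else
    1 / (qPoch q q j * qPoch ((q : ℂ) ^ (2 - ν)) q j)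
      * (-1) ^ j * (q : ℂ) ^ (((j * (j + 1) / 2 : ℤ) : ℂ) - (j : ℂ) * ν)
      * phi21 ((q : ℂ) ^ (-j)) ((q : ℂ) ^ (ν - j - 1)) ((q : ℂ) ^ (ν + m)) q
          ((q : ℂ) ^ (j + n + 1))

/-- `P^{(3)}_{m,n,ν}(x; q)`, a sum over `0 ≤ j ≤ max{|n|, |m-n|} - 1` (empty if `m = n = 0`). -/
def P3 (q : ℝ) (m n : ℤ) (ν x : ℂ) : ℂ :=
  ∑ j ∈ Finset.range (max n.natAbs (m - n).natAbs),
    (x / 2) ^ (2 * j) * (q : ℂ) ^ j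
      * (A3 q m n ν ((j : ℤ) + min m 0) - B3 q m n ν ((j : ℤ) - max m 0))

/-- The coefficient `R^{(3)}_{m,n,ν}(x; q)`. -/
def R3 (q : ℝ) (m n : ℤ) (ν x : ℂ) : ℂ :=
  qPochInf ((q : ℂ) ^ (ν + m + 1)) q / qPochInf ((q : ℂ) ^ (ν - 1)) q
    * (q : ℂ) ^ (-(max (m + 1) 0)) * (x / 2) ^ (min (m + 2) (-m)) * P3 q (m + 1) n ν x

/-- The `q`-Lommel polynomial `R_{m,ν}(x; q)` of Koelink and Swarttouw
(a Laurent polynomial in `x`). -/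
def qLommel (q : ℝ) (m : ℕ) (ν x : ℂ) : ℂ :=
  ∑ j ∈ Finset.range (m + 1),
    x ^ (2 * (j : ℤ) - (m : ℤ))
      * (qPochInf ((q : ℂ) ^ (j + 1)) q * qPochInf ((q : ℂ) ^ ν) q
          / (qPochInf q q * qPochInf ((q : ℂ) ^ (ν + m - j)) q))
      * phi21 ((q : ℂ) ^ (-(j : ℤ))) ((q : ℂ) ^ (ν + m - j)) ((q : ℂ) ^ ν) q ((q : ℂ) ^ (j + 1))

end QBessel

end

noncomputable section

namespace QBessel

open PowerSeries Filter Topology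

/-! ### Finite `q`-shifted factorials -/

/-! Put `u = q^ν` and `z = q (x/2)^2`. Up to infinite products and powers of `x/2`, each Bessel
function in the recurrence is `₁φ₁(0; vq; q, sz)`, with `v` equal to `u q^m`, `u` or `u/q`. The
recurrence thus becomes an identity of formal power series in `X`, where `X` stands for `z`.

The same `q`-difference equation has a second solution, obtained by `v ↦ 1/v` (`hSeries`). Two
products of a first and a second solution, `aSeries` and `bSeries`, have `A_j` and `B_j` as Cauchy
coefficients (`coeff_aSeries`, `coeff_bSeries`). If `P` is replaced by the full difference of these
products, with the shifts by powers of `X`, the recurrence is Cramer's rule: the `aSeries`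
contributions cancel, and the `bSeries` contributions combine to the left-hand side times a
`q`-Wronskian. That Wronskian equals 1, because it is invariant under `X ↦ qX` (`wronskian`,
`recurrence_generic`).

The substantial point is that the full difference is already the finite sum `P`: the coefficients of
the two products agree from degree `max(|n|, |m-n|)` on (`zcoeff_aSeries_eq_zcoeff_bSeries`). After
normalization both families satisfy the same two contiguous relations in `(m, n)`, and they coincide
at `(0, 0)`. At `(1, 0)` their difference is controlled by the Wronskian, and the relations
propagate the bound on its support (`eq_zero_of_contiguity`).

All this is done for generic `u`, nonzero and not an integer power of `q`. Each power series
coefficient is continuous in `u` away from the excluded values, so density extends the identity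
(`recurrence_series`). Absolute convergence then permits evaluation at `z` (`recurrence_eval`). For
`n = 0` and `m ≥ 1` the `B` part vanishes, and the `A` part is the `q`-Lommel polynomial term by
term. -/

lemma qPochNat_zero (a q : ℂ) : qPochNat a q 0 = 1 := by simp [qPochNat]

lemma qPochNat_succ (a q : ℂ) (j : ℕ) :
    qPochNat a q (j + 1) = qPochNat a q j * (1 - a * q ^ j) := by
  simp [qPochNat, Finset.prod_range_succ]

lemma qPochNat_succ' (a q : ℂ) (j : ℕ) :
    qPochNat a q (j + 1) = (1 - a) * qPochNat (a * q) q j := by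
  simp only [qPochNat, Finset.prod_range_succ', pow_zero, mul_one, pow_succ', mul_assoc]
  rw [mul_comm]

lemma qPochNat_zero_left (q : ℂ) (j : ℕ) : qPochNat 0 q j = 1 := by simp [qPochNat]

lemma qPochNat_ne_zero {a q : ℂ} {j : ℕ} (h : ∀ i < j, a * q ^ i ≠ 1) : qPochNat a q j ≠ 0 := by
  refine Finset.prod_ne_zero_iff.2 fun i hi => ?_
  rw [sub_ne_zero]
  exact (h i (Finset.mem_range.1 hi)).symm

lemma qPochNat_self_ne_zero {q : ℂ} (hq : ∀ k : ℕ, q ^ (k + 1) ≠ 1) (j : ℕ) :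
    qPochNat q q j ≠ 0 :=
  qPochNat_ne_zero fun i _ => by rw [← pow_succ']; exact hq i

/-- Reversing the order of the last `k` factors of `(a; q)_j`, where `a b q^(j-1) = 1`. -/
lemma qPochNat_eq_mul_reflect {a b q : ℂ} {j : ℕ} (hab : a * b * q ^ j = q) :
    ∀ k ≤ j, qPochNat a q j * (q ^ (k.choose 2) * q ^ k) =
      qPochNat a q (j - k) * ((-1) ^ k * (a * q ^ j) ^ k * qPochNat b q k) := by
  intro k
  induction k with
  | zero => intro _; simp [qPochNat_zero]
  | succ k ih =>
    intro hk
    have h1 : j - k = (j - (k + 1)) + 1 := by omega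
    have h2 := ih (by omega)
    rw [h1, qPochNat_succ] at h2
    have h3 : q ^ (j - (k + 1)) * q ^ (k + 1) = q ^ j := by rw [← pow_add]; congr 1; omega
    have hc : (k + 1).choose 2 = k.choose 2 + k := by
      rw [Nat.choose_succ_succ' k 1, Nat.choose_one_right, add_comm]
    have h4 : (1 - a * q ^ (j - (k + 1))) * q ^ (k + 1) =
        -(a * q ^ j) * (1 - b * q ^ k) := by
      linear_combination (-a) * h3 - q ^ k * hab
    rw [hc, qPochNat_succ b]
    calc qPochNat a q j * (q ^ (k.choose 2 + k) * q ^ (k + 1))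
        = (qPochNat a q j * (q ^ (k.choose 2) * q ^ k)) * q ^ (k + 1) := by ring
      _ = qPochNat a q (j - (k + 1)) * ((-1) ^ k * (a * q ^ j) ^ k * qPochNat b q k) *
            ((1 - a * q ^ (j - (k + 1))) * q ^ (k + 1)) := by rw [h2]; ring
      _ = _ := by rw [h4]; ring

/-! ### `q`-shifted factorials with integer index -/

lemma qPoch_natCast (a q : ℂ) (j : ℕ) : qPoch a q (j : ℤ) = qPochNat a q j := rfl

lemma qPoch_zero (a q : ℂ) : qPoch a q 0 = 1 := qPochNat_zero a q

lemma qPoch_neg (a q : ℂ) (j : ℕ) :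
    qPoch a q (-(j : ℤ)) = 1 / qPochNat (a * q ^ (-(j : ℤ))) q j := by
  cases j with
  | zero => simp [qPoch_zero, qPochNat_zero]
  | succ j => rfl

/-- The condition is needed only for `m < 0`: there `a q^m = 1` makes the denominator of `qPoch a q
m` zero, so the right side takes the default value 0. -/
lemma qPoch_add_one {a q : ℂ} (hq : q ≠ 0) {m : ℤ} (h : m < 0 → a * q ^ m ≠ 1) :
    qPoch a q (m + 1) = qPoch a q m * (1 - a * q ^ m) := by
  rcases le_or_gt 0 m with hm | hm
  · lift m to ℕ using hm
    have : ((m : ℤ) + 1) = ((m + 1 : ℕ) : ℤ) := by push_cast; rfl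
    rw [this, qPoch_natCast, qPoch_natCast, qPochNat_succ, zpow_natCast]
  · obtain ⟨l, rfl⟩ : ∃ l : ℕ, m = -((l + 1 : ℕ) : ℤ) := ⟨(-m - 1).toNat, by omega⟩
    have h1 : -((l + 1 : ℕ) : ℤ) + 1 = -(l : ℤ) := by push_cast; ring
    have h2 : a * q ^ (-((l + 1 : ℕ) : ℤ)) * q = a * q ^ (-(l : ℤ)) := by
      rw [mul_assoc, ← zpow_add_one₀ hq, h1]
    have h3 := sub_ne_zero.2 (h hm).symm
    rw [h1, qPoch_neg, qPoch_neg, qPochNat_succ', h2]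
    field_simp

lemma qPoch_ne_zero {a q : ℂ} (hq : q ≠ 0) (h : ∀ k : ℤ, a * q ^ k ≠ 1) (m : ℤ) :
    qPoch a q m ≠ 0 := by
  rcases le_total 0 m with hm | hm
  · lift m to ℕ using hm
    exact qPochNat_ne_zero fun i _ => by exact_mod_cast h i
  · obtain ⟨l, rfl⟩ : ∃ l : ℕ, m = -(l : ℤ) := ⟨(-m).toNat, by omega⟩
    rw [qPoch_neg]
    refine one_div_ne_zero (qPochNat_ne_zero fun i _ => ?_)
    rw [mul_assoc, ← zpow_natCast, ← zpow_add₀ hq]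
    exact h _

lemma qPoch_mul_shift {a q : ℂ} (hq : q ≠ 0) (h : ∀ k : ℤ, a * q ^ k ≠ 1) (m : ℤ) :
    (1 - a) * qPoch (a * q) q m = qPoch a q (m + 1) := by
  have h' : ∀ k : ℤ, a * q * q ^ k ≠ 1 := fun k => by
    rw [mul_assoc, ← zpow_one_add₀ hq]; exact h _
  induction m using Int.induction_on with
  | zero =>
    rw [qPoch_add_one hq fun _ => h 0, qPoch_zero, qPoch_zero]; simp
  | succ i ih =>
    rw [qPoch_add_one hq fun _ => h' _, qPoch_add_one hq fun _ => h _, ← ih, zpow_add_one₀ hq]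
    ring
  | pred i ih =>
    have e : (-(i : ℤ)) = (-(i : ℤ) - 1) + 1 := by ring
    rw [e, qPoch_add_one hq fun _ => h' _, qPoch_add_one hq fun _ => h _] at ih
    have e2 : a * q * q ^ (-(i : ℤ) - 1) = a * q ^ (-(i : ℤ) - 1 + 1) := by
      rw [zpow_add_one₀ hq]; ring
    rw [e2] at ih
    refine mul_right_cancel₀ (sub_ne_zero.2 (h (-(i : ℤ) - 1 + 1)).symm) ?_
    rw [← ih]; ring

lemma qPoch_sub_mul {a q : ℂ} (hq : q ≠ 0) (h : ∀ k : ℤ, a * q ^ k ≠ 1) (m : ℤ) (l : ℕ) :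
    qPoch a q (m - l) * qPochNat (a * q ^ (m - l)) q l = qPoch a q m := by
  induction l with
  | zero => simp [qPochNat_zero]
  | succ l ih =>
    have e : m - (l : ℤ) = m - ((l + 1 : ℕ) : ℤ) + 1 := by push_cast; ring
    rw [← ih, qPochNat_succ', e, qPoch_add_one hq fun _ => h _, zpow_add_one₀ hq]
    ring_nf

/-! ### A two-dimensional recurrence bounding the support of its solutions -/

/-- A solution of the contiguity recurrences which vanishes at `(0, 0)` and is supported in negative
degree at `(1, 0)` is supported in degrees less than `max (n - m) (-n)` at `(m, n)`. -/
lemma eq_zero_of_contiguity {q u : ℂ} (hq : q ≠ 0) (hu : u ≠ 0) (s : ℤ → ℤ → ℤ → ℂ)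
    (h1 : ∀ m n i, s m n i - s m (n + 1) i = -q ^ n * s (m + 1) (n + 1) (i - 1))
    (h2 : ∀ m n i, s m n i - u * q ^ (m - 1) * s m (n + 1) i = s (m - 1) n i)
    (h00 : ∀ i, s 0 0 i = 0) (h10 : ∀ i, 0 ≤ i → s 1 0 i = 0) (m n i : ℤ)
    (hi : max (n - m) (-n) ≤ i) : s m n i = 0 := by
  -- Eliminating the row `m = 1` leaves a second-order recurrence in `n` within the row `m = 0`.
  have h3 : ∀ n i, q * (s 0 (n + 1) i - s 0 n i) - u * (s 0 (n + 2) i - s 0 (n + 1) i) =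
      q ^ (n + 1) * s 0 (n + 1) (i - 1) := by
    intro n i
    have a1 := h1 0 n i
    have a2 := h1 0 (n + 1) i
    have a3 := h2 1 (n + 1) (i - 1)
    simp only [zero_add, sub_self, zpow_zero, mul_one, add_assoc, one_add_one_eq_two] at a1 a2 a3
    rw [zpow_add_one₀ hq] at a2 ⊢
    linear_combination (-q) * a1 + u * a2 + q ^ n * q * a3
  have h01 : ∀ i, 1 ≤ i → s 0 1 i = 0 := by
    intro i hi
    have a1 := h1 0 0 i
    have a2 := h2 1 0 (i - 1)
    simp only [zero_add, sub_self, zpow_zero, mul_one, h00, h10 (i - 1) (by omega)] at a1 a2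
    have : s 1 1 (i - 1) = 0 := by
      have : u * s 1 1 (i - 1) = 0 := by linear_combination -a2
      exact (mul_eq_zero.1 this).resolve_left hu
    rw [this] at a1
    linear_combination -a1
  -- Since the recurrence has order two, the induction carries two consecutive columns; `hdown` does
  -- the same for negative `n`.
  have hup : ∀ n : ℕ, (∀ i, (n : ℤ) ≤ i → s 0 n i = 0) ∧
      ∀ i, (n : ℤ) + 1 ≤ i → s 0 (n + 1) i = 0 := by
    intro n
    induction n with
    | zero => exact ⟨fun i _ => h00 i, fun i hi => by simpa using h01 i (by simpa using hi)⟩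
    | succ n ih =>
      refine ⟨fun i hi => by exact_mod_cast ih.2 i (by exact_mod_cast hi), fun i hi => ?_⟩
      push_cast at hi ⊢
      have a := h3 n i
      rw [ih.1 i (by omega), ih.2 i (by omega), ih.2 (i - 1) (by omega)] at a
      have : u * s 0 (n + 2) i = 0 := by linear_combination -a
      rw [add_assoc, one_add_one_eq_two]
      exact (mul_eq_zero.1 this).resolve_left hu
  have hdown : ∀ n : ℕ, (∀ i, (n : ℤ) ≤ i → s 0 (-n) i = 0) ∧
      ∀ i, (n : ℤ) + 1 ≤ i → s 0 (-n - 1) i = 0 := by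
    have step : ∀ (n : ℤ) (i : ℤ), s 0 (n + 1) i = 0 → s 0 (n + 2) i = 0 →
        s 0 (n + 1) (i - 1) = 0 → s 0 n i = 0 := by
      intro n i b1 b2 b3
      have a := h3 n i
      rw [b1, b2, b3] at a
      have : q * s 0 n i = 0 := by linear_combination -a
      exact (mul_eq_zero.1 this).resolve_left hq
    intro n
    induction n with
    | zero =>
      refine ⟨fun i _ => by simpa using h00 i, fun i hi => step _ i ?_ ?_ ?_⟩
      · simpa using h00 i
      · simpa using h01 i (by simpa using hi)
      · simpa using h00 (i - 1)
    | succ n ih =>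
      have e0 : -((n + 1 : ℕ) : ℤ) = -(n : ℤ) - 1 := by push_cast; ring
      rw [e0]
      refine ⟨fun i hi => ih.2 i (by exact_mod_cast hi), fun i hi => step _ i ?_ ?_ ?_⟩
      · rw [sub_add_cancel]; exact ih.2 i (by push_cast at hi; omega)
      · rw [show -(n : ℤ) - 1 - 1 + 2 = -n by ring]; exact ih.1 i (by push_cast at hi; omega)
      · rw [sub_add_cancel]; exact ih.2 (i - 1) (by push_cast at hi; omega)
  have h0 : ∀ n i, max (n - 0) (-n) ≤ i → s 0 n i = 0 := by
    intro n i hi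
    rcases le_total 0 n with hn | hn
    · lift n to ℕ using hn
      exact (hup n).1 i (by omega)
    · obtain ⟨l, rfl⟩ : ∃ l : ℕ, n = -(l : ℤ) := ⟨(-n).toNat, by omega⟩
      exact (hdown l).1 i (by omega)
  -- Away from the row `m = 0`, `h1` expresses row `m + 1` through row `m` one degree higher, and
  -- `h2` expresses row `m - 1` through row `m` in the same degree.
  induction m using Int.induction_on generalizing n i with
  | zero => exact h0 n i hi
  | succ m ih =>
    have a := h1 m (n - 1) (i + 1)
    rw [sub_add_cancel, add_sub_cancel_right, ih _ _ (by omega), ih _ _ (by omega)] at a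
    have : q ^ (n - 1) * s (m + 1) n i = 0 := by linear_combination a
    exact (mul_eq_zero.1 this).resolve_left (zpow_ne_zero _ hq)
  | pred m ih =>
    have a := h2 (-m) n i
    rw [ih _ _ (by omega), ih _ _ (by omega)] at a
    rw [← a]; ring

/-! ### The power series underlying the third `q`-Bessel function -/

/-- The coefficients of `₁φ₁(0; vq; q, x)`. -/
def fCoeff (q v : ℂ) (k : ℕ) : ℂ :=
  (-1) ^ k * q ^ (k.choose 2) / (qPochNat q q k * qPochNat (v * q) q k)

/-- The formal power series `₁φ₁(0; vq; q, sX)`. -/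
def fSeries (q v s : ℂ) : PowerSeries ℂ := PowerSeries.mk fun k => fCoeff q v k * s ^ k

/-- The power series of the second solution of the `q`-difference equation of `fSeries q v s`. -/
def hSeries (q v s : ℂ) : PowerSeries ℂ := fSeries q v⁻¹ (v⁻¹ * s)

lemma fCoeff_zero (q v : ℂ) : fCoeff q v 0 = 1 := by simp [fCoeff, qPochNat_zero]

lemma fCoeff_succ_mul {q v : ℂ} (hq : ∀ k : ℕ, q ^ (k + 1) ≠ 1)
    (hv : ∀ k : ℕ, v * q ^ (k + 1) ≠ 1) (k : ℕ) :
    fCoeff q v (k + 1) * (1 - q ^ (k + 1)) = -(q ^ k / (1 - v * q)) * fCoeff q (v * q) k := by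
  have h1 : 1 - q ^ (k + 1) ≠ 0 := sub_ne_zero.2 (hq k).symm
  have h2 : 1 - v * q ≠ 0 := sub_ne_zero.2 (by simpa using (hv 0).symm)
  have h3 := qPochNat_self_ne_zero hq k
  have h4 : qPochNat (v * q * q) q k ≠ 0 := qPochNat_ne_zero fun i _ => by
    have := hv (i + 1); rwa [pow_succ', pow_succ', ← mul_assoc, ← mul_assoc] at this
  have hc : (k + 1).choose 2 = k.choose 2 + k := by
    rw [Nat.choose_succ_succ' k 1, Nat.choose_one_right, add_comm]
  rw [fCoeff, fCoeff, qPochNat_succ q, ← pow_succ', qPochNat_succ', hc]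
  field_simp
  ring

lemma fCoeff_mul {q v : ℂ} (hq0 : q ≠ 0) (hv : ∀ k : ℕ, v * q ^ k ≠ 1) (k : ℕ) :
    fCoeff q v k * (1 - v * q ^ k) = (1 - v) * fCoeff q (v / q) k := by
  have h2 : 1 - v ≠ 0 := sub_ne_zero.2 (by simpa using (hv 0).symm)
  have h5 : 1 - v * q ^ k ≠ 0 := sub_ne_zero.2 (hv k).symm
  have h6 : qPochNat (v * q) q k ≠ 0 := qPochNat_ne_zero fun i _ => by
    have := hv (i + 1); rwa [pow_succ', ← mul_assoc] at this
  have h7 : qPochNat v q k = (1 - v) * qPochNat (v * q) q k / (1 - v * q ^ k) := by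
    rw [← qPochNat_succ', qPochNat_succ]; field_simp
  rw [fCoeff, fCoeff, div_mul_cancel₀ _ hq0, h7]
  by_cases h3 : qPochNat q q k = 0
  · simp [h3]
  field_simp

lemma rescale_fSeries (q v s a : ℂ) : rescale a (fSeries q v s) = fSeries q v (a * s) := by
  ext k; simp [fSeries, coeff_rescale]; ring

/-- The factor `1 - q^k` cancels the last factor of `(q; q)_k`, which shifts the index and raises
`v` to `vq`. -/
lemma fSeries_sub {q v : ℂ} (hq : ∀ k : ℕ, q ^ (k + 1) ≠ 1)
    (hv : ∀ k : ℕ, v * q ^ (k + 1) ≠ 1) (s : ℂ) :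
    fSeries q v s - fSeries q v (q * s) =
      -(C (s / (1 - v * q)) * (X * fSeries q (v * q) (q * s))) := by
  ext k
  cases k with
  | zero => simp [fSeries, fCoeff_zero]
  | succ k =>
    have := fCoeff_succ_mul hq hv k
    simp only [map_sub, map_neg, coeff_C_mul, coeff_succ_X_mul, fSeries, coeff_mk]
    rw [mul_pow, mul_pow]
    linear_combination s ^ (k + 1) * this

/-- The factor `1 - v q^k` cancels the last factor of `(vq; q)_k`, which lowers `v` to `v/q`. -/
lemma fSeries_sub_mul {q v : ℂ} (hq0 : q ≠ 0) (hv : ∀ k : ℕ, v * q ^ k ≠ 1) (s : ℂ) :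
    fSeries q v s - C v * fSeries q v (q * s) = C (1 - v) * fSeries q (v / q) s := by
  ext k
  have := fCoeff_mul hq0 hv k
  rw [map_sub, coeff_C_mul, coeff_C_mul]
  simp only [fSeries, coeff_mk, mul_pow]
  linear_combination s ^ k * this

lemma inv_mul_zpow_ne_one {q v : ℂ} (hv : ∀ k : ℤ, v * q ^ k ≠ 1) (k : ℤ) :
    v⁻¹ * q ^ k ≠ 1 := by
  intro h
  apply hv (-k)
  rw [zpow_neg, ← inv_inv v, ← mul_inv, h, inv_one]

/-- Because `hSeries` inverts `v`, the lowering relation of `fSeries` becomes a raising one here;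
conversely, `hSeries_sub` lowers `v`. -/
lemma hSeries_sub_mul {q v : ℂ} (hq0 : q ≠ 0) (hv : ∀ k : ℤ, v * q ^ k ≠ 1) (s : ℂ) :
    hSeries q v s - C v⁻¹ * hSeries q v (q * s) = C (1 - v⁻¹) * hSeries q (v * q) (q * s) := by
  have := fSeries_sub_mul hq0 (v := v⁻¹)
    (fun k => by exact_mod_cast inv_mul_zpow_ne_one hv k) (v⁻¹ * s)
  have e1 : v⁻¹ / q = (v * q)⁻¹ := by rw [mul_inv]; rfl
  have e2 : (v * q)⁻¹ * (q * s) = v⁻¹ * s := by rw [mul_inv]; field_simp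
  rw [hSeries, hSeries, hSeries, e2, ← e1, ← this]
  ring_nf

lemma hSeries_sub {q v : ℂ} (hq : ∀ k : ℕ, q ^ (k + 1) ≠ 1) (hq0 : q ≠ 0)
    (hv : ∀ k : ℤ, v * q ^ k ≠ 1) (hv0 : v ≠ 0) (s : ℂ) :
    hSeries q v s - hSeries q v (q * s) = -(C (s / (v - q)) * (X * hSeries q (v / q) s)) := by
  have := fSeries_sub hq (v := v⁻¹)
    (fun k => by exact_mod_cast inv_mul_zpow_ne_one hv (k + 1 : ℕ)) (v⁻¹ * s)
  have e1 : v⁻¹ * q = (v / q)⁻¹ := by rw [inv_div]; field_simp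
  have e2 : q * (v⁻¹ * s) = (v / q)⁻¹ * s := by rw [inv_div]; field_simp
  have e3 : v⁻¹ * s / (1 - v⁻¹ * q) = s / (v - q) := by
    rw [show v - q = v * (1 - v⁻¹ * q) by field_simp, inv_mul_eq_div, div_div]
  rw [e3, e2, e1] at this
  rw [hSeries, hSeries, hSeries, ← this, ← e2]
  ring_nf

/-- The `q`-Wronskian of the two solutions. -/
lemma wronskian {q u : ℂ} (hq : ∀ k : ℕ, q ^ (k + 1) ≠ 1) (hq0 : q ≠ 0)
    (hu : ∀ k : ℤ, u * q ^ k ≠ 1) (hu0 : u ≠ 0) :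
    hSeries q u 1 * fSeries q (u / q) 1
      - C (1 / ((q - u) * (1 - u))) * (X * (hSeries q (u / q) 1 * fSeries q u 1)) = 1 := by
  set W := hSeries q u 1 * fSeries q (u / q) 1
      - C (1 / ((q - u) * (1 - u))) * (X * (hSeries q (u / q) 1 * fSeries q u 1)) with hW
  have hu' : ∀ k : ℤ, u / q * q ^ k ≠ 1 := fun k => by
    have := hu (k - 1)
    rw [zpow_sub_one₀ hq0] at this
    convert this using 1; field_simp
  have n1 : 1 - u ≠ 0 := sub_ne_zero.2 (by simpa using (hu 0).symm)
  have n2 : q - u ≠ 0 := sub_ne_zero.2 fun h => hu (-1) (by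
    rw [← h, zpow_neg_one, mul_inv_cancel₀ hq0])
  have b := fSeries_sub_mul hq0 (fun k => by exact_mod_cast hu k) (1 : ℂ)
  have a := fSeries_sub hq (v := u / q) (fun k => by exact_mod_cast hu' (k + 1 : ℕ)) (1 : ℂ)
  have c := hSeries_sub hq hq0 hu hu0 1
  have d := hSeries_sub_mul hq0 hu' 1
  rw [div_mul_cancel₀ _ hq0] at a d
  -- Invariance under `X ↦ qX`: the four contiguous relations express the rescaled factors, and `k1`
  -- and `k2` write their constants as multiples of the single constant `1/((q-u)(1-u))`.
  have hr : rescale q W = W := by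
    have r1 : ∀ v, rescale q (hSeries q v 1) = hSeries q v (q * 1) := fun v => by
      rw [hSeries, rescale_fSeries, hSeries]; ring_nf
    have r2 : rescale q (C (1 / ((q - u) * (1 - u)))) = C (1 / ((q - u) * (1 - u))) := by
      ext k; rw [coeff_rescale, coeff_C]; split_ifs with h <;> simp [h]
    have r3 : rescale q (X : PowerSeries ℂ) = C q * X := by
      ext k; rw [coeff_rescale, coeff_C_mul, coeff_X]; split_ifs with h <;> simp [h]
    rw [hW, map_sub, map_mul, map_mul, map_mul, map_mul, r1, r1, r2, r3, rescale_fSeries,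
      rescale_fSeries]
    have k1 : C (1 / (1 - u)) = C (1 / ((q - u) * (1 - u))) * (C q - C u) := by
      rw [← map_sub, ← map_mul]; congr 1; field_simp
    have k2 : C (1 / (u - q)) = -(C (1 / ((q - u) * (1 - u))) * (1 - C u)) := by
      have n3 : u - q ≠ 0 := by rw [← neg_sub]; exact neg_ne_zero.2 n2
      rw [← map_one C, ← map_sub, ← map_mul, ← map_neg]; congr 1; field_simp; ring
    have k3 : C u * C (u / q)⁻¹ = C q := by
      rw [← map_mul]; congr 1; field_simp
    rw [k1] at a
    rw [k2] at c
    rw [map_sub, map_one] at b d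
    generalize C (1 / ((q - u) * (1 - u))) = K at *
    generalize C (u / q)⁻¹ = L at *
    linear_combination (-fSeries q (u / q) 1) * c - hSeries q u (q * 1) * a
      + K * X * hSeries q (u / q) 1 * b
      + K * X * fSeries q u (q * 1) *
        (C u * d + (hSeries q (u / q) (q * 1) - hSeries q u (q * 1)) * k3)
  -- Invariance gives `(1 - q^k) W_k = 0`, so only the constant term survives, and it is 1.
  have hk : ∀ k, coeff k W = coeff k (1 : PowerSeries ℂ) := by
    intro k
    cases k with
    | zero => simp [hW, hSeries, fSeries, fCoeff_zero]
    | succ k =>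
      have := congrArg (coeff (k + 1)) hr
      rw [coeff_rescale] at this
      have h2 : (1 - q ^ (k + 1)) * coeff (k + 1) W = 0 := by linear_combination -this
      rw [(mul_eq_zero.1 h2).resolve_left (sub_ne_zero.2 (hq k).symm)]
      simp [coeff_one]
  exact PowerSeries.ext hk

/-! ### Integer-indexed coefficients of power series -/

/-- The coefficient of a power series at an integer index, zero at negative indices. -/
def zcoeff (p : PowerSeries ℂ) (i : ℤ) : ℂ := if i < 0 then 0 else coeff i.toNat p

lemma zcoeff_natCast (p : PowerSeries ℂ) (k : ℕ) : zcoeff p k = coeff k p := by simp [zcoeff]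

lemma zcoeff_sub (p r : PowerSeries ℂ) (i : ℤ) : zcoeff (p - r) i = zcoeff p i - zcoeff r i := by
  unfold zcoeff; split_ifs <;> simp

lemma zcoeff_neg (p : PowerSeries ℂ) (i : ℤ) : zcoeff (-p) i = -zcoeff p i := by
  unfold zcoeff; split_ifs <;> simp

lemma zcoeff_C_mul (a : ℂ) (p : PowerSeries ℂ) (i : ℤ) :
    zcoeff (C a * p) i = a * zcoeff p i := by
  unfold zcoeff; split_ifs <;> simp

lemma zcoeff_X_mul (p : PowerSeries ℂ) (i : ℤ) : zcoeff (X * p) i = zcoeff p (i - 1) := by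
  rcases lt_trichotomy i 0 with h | rfl | h
  · simp [zcoeff, h, show i - 1 < 0 by omega]
  · simp [zcoeff]
  · obtain ⟨k, rfl⟩ : ∃ k : ℕ, i = ((k + 1 : ℕ) : ℤ) := ⟨(i - 1).toNat, by omega⟩
    rw [zcoeff_natCast, coeff_succ_X_mul, ← zcoeff_natCast]; congr 1; push_cast; ring

/-! ### The two product series and the coincidence of their high coefficients -/

/-- The generating series of the coefficients `A3` for generic `u = q ^ ν`. -/
def aSeries (q u : ℂ) (m n : ℤ) : PowerSeries ℂ :=
  C (qPoch u q m * (qPoch (u / q) q m * q ^ m * (u * q ^ (m - 1)) ^ (-n))) *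
    (hSeries q (u * q ^ (m - 1)) (q ^ n) * fSeries q (u / q) 1)

/-- The generating series of the coefficients `B3` for generic `u = q ^ ν`. -/
def bSeries (q u : ℂ) (m n : ℤ) : PowerSeries ℂ :=
  fSeries q (u * q ^ (m - 1)) (q ^ n) * hSeries q (u / q) 1

lemma mul_zpow_mul_ne_one {q u : ℂ} (hq0 : q ≠ 0) (hu : ∀ k : ℤ, u * q ^ k ≠ 1) (l k : ℤ) :
    u * q ^ l * q ^ k ≠ 1 := by
  rw [mul_assoc, ← zpow_add₀ hq0]; exact hu _

lemma div_mul_ne_one {q u : ℂ} (hq0 : q ≠ 0) (hu : ∀ k : ℤ, u * q ^ k ≠ 1) (k : ℤ) :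
    u / q * q ^ k ≠ 1 := by
  simpa [div_eq_mul_inv] using mul_zpow_mul_ne_one hq0 hu (-1) k

/-- The difference of the two normalized coefficient families solves the contiguity recurrences, so
its support is bounded by `eq_zero_of_contiguity`. This is what makes `P` a polynomial. -/
lemma zcoeff_aSeries_eq_zcoeff_bSeries {q u : ℂ} (hq : ∀ k : ℕ, q ^ (k + 1) ≠ 1) (hq0 : q ≠ 0)
    (hu : ∀ k : ℤ, u * q ^ k ≠ 1) (hu0 : u ≠ 0) (m n i : ℤ) (hi : max (n - m) (-n) ≤ i) :
    zcoeff (aSeries q u m n) (i + m) = zcoeff (bSeries q u m n) i := by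
  have hP : ∀ m, qPoch u q m ≠ 0 := qPoch_ne_zero hq0 hu
  have hu' := div_mul_ne_one hq0 hu
  have hPs : ∀ m, qPoch u q (m + 1) = qPoch u q m * (1 - u * q ^ m) := fun m =>
    qPoch_add_one hq0 fun _ => hu m
  have hPs' : ∀ m, qPoch (u / q) q (m + 1) = qPoch (u / q) q m * (1 - u * q ^ (m - 1)) := fun m => by
    rw [qPoch_add_one hq0 fun _ => hu' m, zpow_sub_one₀ hq0]; ring
  have n1 : ∀ m : ℤ, 1 - u * q ^ m ≠ 0 := fun m => sub_ne_zero.2 (hu m).symm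
  -- Dividing by `(u; q)_m` absorbs the factors `1 - u q^(m-1)` and `1 - u q^m`, so that both
  -- families obey the relations with identical constants.
  set A : ℤ → ℤ → PowerSeries ℂ := fun m n => C (1 / qPoch u q m) * aSeries q u m n with hA
  set B : ℤ → ℤ → PowerSeries ℂ := fun m n => C (1 / qPoch u q m) * bSeries q u m n with hB
  have eA : ∀ m n, A m n = C (qPoch (u / q) q m * q ^ m * (u * q ^ (m - 1)) ^ (-n)) *
      (hSeries q (u * q ^ (m - 1)) (q ^ n) * fSeries q (u / q) 1) := fun m n => by
    rw [hA]; simp only [aSeries]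
    rw [← mul_assoc, ← map_mul, one_div, inv_mul_cancel_left₀ (hP m)]
  have ev : ∀ m : ℤ, u * q ^ (m + 1 - 1) = u * q ^ (m - 1) * q := fun m => by
    rw [add_sub_cancel_right, mul_assoc, ← zpow_add_one₀ hq0, sub_add_cancel]
  have ev' : ∀ m : ℤ, u * q ^ (m - 1) / q = u * q ^ (m - 1 - 1) := fun m => by
    rw [zpow_sub_one₀ hq0 (m - 1)]; ring
  have es : ∀ n : ℤ, q ^ (n + 1) = q * q ^ n := fun n => by rw [zpow_add_one₀ hq0, mul_comm]
  have B1 : ∀ m n, B m n - B m (n + 1) = -(C (q ^ n) * (X * B (m + 1) (n + 1))) := by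
    intro m n
    have := fSeries_sub hq (v := u * q ^ (m - 1))
      (fun k => by exact_mod_cast mul_zpow_mul_ne_one hq0 hu (m - 1) (k + 1 : ℕ)) (q ^ n)
    simp only [hB, bSeries, ev, es, hPs]
    have e : C (q ^ n) * C (1 / (qPoch u q m * (1 - u * q ^ m))) =
        C (1 / qPoch u q m) * C (q ^ n / (1 - u * q ^ (m - 1) * q)) := by
      rw [← map_mul, ← map_mul, ← ev, add_sub_cancel_right]; congr 1
      have := hP m; have := n1 m; field_simp
    linear_combination (C (1 / qPoch u q m) * hSeries q (u / q) 1) * this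
      + X * fSeries q (u * q ^ (m - 1) * q) (q * q ^ n) * hSeries q (u / q) 1 * e
  have B2 : ∀ m n, B m n - C (u * q ^ (m - 1)) * B m (n + 1) = B (m - 1) n := by
    intro m n
    have := fSeries_sub_mul hq0 (v := u * q ^ (m - 1))
      (fun k => by exact_mod_cast mul_zpow_mul_ne_one hq0 hu (m - 1) k) (q ^ n)
    rw [ev'] at this
    have e : C (1 / qPoch u q m) * C (1 - u * q ^ (m - 1)) = C (1 / qPoch u q (m - 1)) := by
      have h := hPs (m - 1)
      rw [sub_add_cancel] at h
      rw [← map_mul, h]; congr 1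
      have := hP (m - 1); have := n1 (m - 1); field_simp
    simp only [hB, bSeries, es]
    linear_combination (C (1 / qPoch u q m) * hSeries q (u / q) 1) * this
      + fSeries q (u * q ^ (m - 1 - 1)) (q ^ n) * hSeries q (u / q) 1 * e
  have hv0 : ∀ m : ℤ, u * q ^ m ≠ 0 := fun m => mul_ne_zero hu0 (zpow_ne_zero _ hq0)
  have A1 : ∀ m n, A m n - A m (n + 1) = -(C (q ^ n) * A (m + 1) (n + 1)) := by
    intro m n
    have := hSeries_sub_mul hq0 (mul_zpow_mul_ne_one hq0 hu (m - 1)) (q ^ n)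
    have hv := hv0 (m - 1)
    rw [eA, eA, eA]
    simp only [ev, es, hPs']
    generalize hvd : u * q ^ (m - 1) = v at *
    have e1 : C (qPoch (u / q) q m * q ^ m * v ^ (-(n + 1))) =
        C (qPoch (u / q) q m * q ^ m * v ^ (-n)) * C v⁻¹ := by
      rw [← map_mul, neg_add, ← sub_eq_add_neg, zpow_sub_one₀ hv, mul_assoc _ _ v⁻¹]
    have e2 : C (q ^ n) * C (qPoch (u / q) q m * (1 - v) * (q * q ^ m) * (v * q) ^ (-(n + 1))) =
        -(C (qPoch (u / q) q m * q ^ m * v ^ (-n)) * C (1 - v⁻¹)) := by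
      rw [← map_mul, ← map_mul, ← map_neg, neg_add, ← sub_eq_add_neg,
        zpow_sub_one₀ (mul_ne_zero hv hq0), mul_zpow, zpow_neg, zpow_neg]
      congr 1
      have := zpow_ne_zero n hq0
      have := zpow_ne_zero n hv
      field_simp
      ring
    linear_combination (C (qPoch (u / q) q m * q ^ m * v ^ (-n)) * fSeries q (u / q) 1) * this
      - hSeries q v (q * q ^ n) * fSeries q (u / q) 1 * e1
      + hSeries q (v * q) (q * q ^ n) * fSeries q (u / q) 1 * e2
  have A2 : ∀ m n, A m n - C (u * q ^ (m - 1)) * A m (n + 1) = X * A (m - 1) n := by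
    intro m n
    have := hSeries_sub hq hq0 (mul_zpow_mul_ne_one hq0 hu (m - 1)) (hv0 (m - 1)) (q ^ n)
    have hv := hv0 (m - 1)
    have hPm := hPs' (m - 1)
    have hvq : u * q ^ (m - 1) - q ≠ 0 := by
      refine sub_ne_zero.2 fun h => mul_zpow_mul_ne_one hq0 hu (m - 1) (-1) ?_
      rw [h, zpow_neg_one, mul_inv_cancel₀ hq0]
    rw [eA, eA, eA, ← ev']
    rw [sub_add_cancel, ← ev'] at hPm
    simp only [es, hPm]
    generalize hvd : u * q ^ (m - 1) = v at *
    have e1 : C v * C (qPoch (u / q) q (m - 1) * (1 - v / q) * q ^ m * v ^ (-(n + 1))) =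
        C (qPoch (u / q) q (m - 1) * (1 - v / q) * q ^ m * v ^ (-n)) := by
      rw [← map_mul, neg_add, ← sub_eq_add_neg, zpow_sub_one₀ hv]; congr 1; field_simp
    have e2 : C (qPoch (u / q) q (m - 1) * (1 - v / q) * q ^ m * v ^ (-n)) * C (q ^ n / (v - q)) =
        -C (qPoch (u / q) q (m - 1) * q ^ (m - 1) * (v / q) ^ (-n)) := by
      rw [← map_mul, ← map_neg, div_zpow, zpow_neg, zpow_neg, zpow_sub_one₀ hq0]
      congr 1
      have := zpow_ne_zero n hq0
      have := zpow_ne_zero n hv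
      field_simp
      ring
    linear_combination
      (C (qPoch (u / q) q (m - 1) * (1 - v / q) * q ^ m * v ^ (-n)) * fSeries q (u / q) 1) * this
      - hSeries q v (q * q ^ n) * fSeries q (u / q) 1 * e1
      - X * hSeries q (v / q) (q ^ n) * fSeries q (u / q) 1 * e2
  -- In the first relation only the `B` version carries an `X`, in the second only the `A` version;
  -- reading `A` at degree `i + m` compensates for both.
  have key := eq_zero_of_contiguity hq0 hu0 (fun m n i => zcoeff (B m n) i - zcoeff (A m n) (i + m))
    (fun m n i => by
      have b := congrArg (zcoeff · i) (B1 m n)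
      have a := congrArg (zcoeff · (i + m)) (A1 m n)
      simp only [zcoeff_sub, zcoeff_neg, zcoeff_C_mul, zcoeff_X_mul] at a b
      rw [show i - 1 + (m + 1) = i + m by ring]
      linear_combination b - a)
    (fun m n i => by
      have b := congrArg (zcoeff · i) (B2 m n)
      have a := congrArg (zcoeff · (i + m)) (A2 m n)
      simp only [zcoeff_sub, zcoeff_C_mul, zcoeff_X_mul] at a b
      rw [show i + (m - 1) = i + m - 1 by ring]
      linear_combination b - a)
    (fun i => by
      rw [eA]; simp only [hB, bSeries]
      rw [show u * q ^ ((0 : ℤ) - 1) = u / q by rw [zero_sub, zpow_neg_one]; rfl]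
      simp [qPoch_zero, mul_comm])
    -- At `(1, 0)` the two products are those in the Wronskian, whose coefficients of degree `i + 1
    -- ≥ 1` vanish.
    (fun i hi => by
      have w := wronskian hq hq0 hu hu0
      have n2 : q - u ≠ 0 := sub_ne_zero.2 fun h => hu (-1) (by
        rw [← h, zpow_neg_one, mul_inv_cancel₀ hq0])
      have n3 : 1 - u ≠ 0 := by simpa using n1 0
      have p1 := hPs 0
      have p2 := hPs' 0
      simp only [zero_add, qPoch_zero, one_mul, zpow_zero, mul_one, zero_sub, zpow_neg_one] at p1 p2
      have w' := congrArg (zcoeff · (i + 1)) w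
      have h1 : zcoeff (1 : PowerSeries ℂ) (i + 1) = 0 := by
        lift i to ℕ using hi
        rw [← Nat.cast_succ, zcoeff_natCast, coeff_one]; simp
      simp only [zcoeff_sub, zcoeff_C_mul, zcoeff_X_mul, h1, add_sub_cancel_right] at w'
      rw [eA]; simp only [hB, bSeries]
      simp only [p1, p2, zcoeff_C_mul, sub_self, zpow_zero, mul_one, neg_zero, zpow_one]
      rw [sub_eq_zero.1 w', mul_comm (fSeries q u 1)]
      field_simp
      ring)
    m n i hi
  simp only [hA, hB, zcoeff_C_mul] at key
  rw [← mul_sub] at key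
  exact (sub_eq_zero.1 ((mul_eq_zero.1 key).resolve_left (one_div_ne_zero (hP m)))).symm

/-! ### The coefficients as finite sums -/

/-- The terminating series `₂φ₁(q^(-j), b; c; q, y)` as a finite sum. -/
def phiTrunc (b c q y : ℂ) (j : ℕ) : ℂ :=
  ∑ k ∈ Finset.range (j + 1), qPochNat (q ^ (-(j : ℤ))) q k * qPochNat b q k /
    (qPochNat q q k * qPochNat c q k) * y ^ k

lemma phi21_eq_phiTrunc {q : ℂ} (hq0 : q ≠ 0) (b c y : ℂ) (j : ℕ) :
    phi21 (q ^ (-(j : ℤ))) b c q y = phiTrunc b c q y j := by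
  refine tsum_eq_sum fun k hk => ?_
  have h : qPochNat (q ^ (-(j : ℤ))) q k = 0 := by
    refine Finset.prod_eq_zero (i := j) (by have := Finset.mem_range.not.1 hk; exact Finset.mem_range.2 (by omega)) ?_
    rw [zpow_neg, zpow_natCast, inv_mul_cancel₀ (pow_ne_zero _ hq0), sub_self]
  rw [h]; simp

/-- The coefficient `A3` as a function of `u = q ^ ν`. -/
def aCoeff (q : ℂ) (m n : ℤ) (u : ℂ) (j : ℕ) : ℂ :=
  qPoch u q m * qPoch (u / q) q (m - j) / qPochNat q q j
    * (q ^ ((j - m + 1) * (n - 1) + 1) * u ^ (-n))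
    * phiTrunc (u * q ^ (m - j - 1)) u q (q ^ (j - n + 1)) j

/-- The coefficient `B3` as a function of `u = q ^ ν`. -/
def bCoeff (q : ℂ) (m n : ℤ) (u : ℂ) (j : ℕ) : ℂ :=
  1 / (qPochNat q q j * qPochNat (q ^ 2 / u) q j)
    * (-1) ^ j * (q ^ ((j + 1).choose 2) * u ^ (-(j : ℤ)))
    * phiTrunc (u * q ^ (-(j : ℤ) - 1)) (u * q ^ m) q (q ^ (j + n + 1)) j

lemma cpow_add_intCast {q : ℂ} (hq : q ≠ 0) (ν : ℂ) (k : ℤ) : q ^ (ν + k) = q ^ ν * q ^ k := by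
  rw [Complex.cpow_add _ _ hq, Complex.cpow_intCast]

lemma cpow_intCast_sub {q : ℂ} (hq : q ≠ 0) (ν : ℂ) (k l : ℤ) :
    q ^ ((k : ℂ) - l * ν) = q ^ k * (q ^ ν) ^ (-l) := by
  rw [Complex.cpow_sub _ _ hq, Complex.cpow_intCast, Complex.cpow_int_mul, zpow_neg]; rfl

lemma A3_natCast {q : ℝ} (hq : q ≠ 0) (m n : ℤ) (ν : ℂ) (j : ℕ) :
    A3 q m n ν j = aCoeff q m n ((q : ℂ) ^ ν) j := by
  have hq' : (q : ℂ) ≠ 0 := by exact_mod_cast hq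
  have e1 := cpow_add_intCast hq' ν (-1)
  have e2 := cpow_add_intCast hq' ν (m - j - 1)
  push_cast at e1 e2
  rw [zpow_neg_one, ← div_eq_mul_inv] at e1
  rw [A3, if_neg (by omega), aCoeff, phi21_eq_phiTrunc hq', cpow_intCast_sub hq',
    ← e2, ← e1, qPoch_natCast]
  simp only [Int.cast_natCast]
  ring_nf

lemma B3_natCast {q : ℝ} (hq : q ≠ 0) (m n : ℤ) (ν : ℂ) (j : ℕ) :
    B3 q m n ν j = bCoeff q m n ((q : ℂ) ^ ν) j := by
  have hq' : (q : ℂ) ≠ 0 := by exact_mod_cast hq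
  have e1 := cpow_add_intCast hq' ν m
  have e2 := cpow_add_intCast hq' ν (-j - 1)
  have e3 := cpow_intCast_sub hq' ν 2 1
  have e4 : ((j : ℤ) * (j + 1) / 2 : ℤ) = ((j + 1).choose 2 : ℕ) := by
    rw [Nat.choose_two_right, Nat.add_sub_cancel, mul_comm]; push_cast; rfl
  have e5 := cpow_intCast_sub hq' ν ((j + 1).choose 2 : ℕ) j
  push_cast at e1 e2 e3 e5
  rw [one_mul, zpow_neg_one, ← div_eq_mul_inv] at e3
  rw [zpow_natCast] at e5
  rw [B3, if_neg (by omega), bCoeff, phi21_eq_phiTrunc hq', e4, ← e1]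
  push_cast
  rw [e5, e3, qPoch_natCast, qPoch_natCast]
  rw [show ν + (-(j : ℂ) - 1) = ν - j - 1 by ring] at e2
  simp only [zpow_natCast, zpow_ofNat, ← e2]

lemma choose_two_add_identity (l k : ℕ) :
    (l + k + 1).choose 2 + k.choose 2 = l.choose 2 + l + l * k + k * k := by
  have : (((l + k + 1).choose 2 + k.choose 2 : ℕ) : ℚ) =
      ((l.choose 2 + l + l * k + k * k : ℕ) : ℚ) := by
    push_cast [Nat.cast_choose_two]; ring
  exact_mod_cast this

lemma two_mul_choose_two_add (l : ℕ) : l.choose 2 + l.choose 2 + l = l * l := by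
  have : ((l.choose 2 + l.choose 2 + l : ℕ) : ℚ) = ((l * l : ℕ) : ℚ) := by
    push_cast [Nat.cast_choose_two]; ring
  exact_mod_cast this

/-- In the Cauchy product, the index `k` on the `fSeries` factor is the summation index of the
`₂φ₁`. Reversing the last `k` factors of `(q; q)_j` and `(q²/u; q)_j` produces its two numerator
parameters. -/
lemma coeff_bSeries {q u : ℂ} (hq : ∀ k : ℕ, q ^ (k + 1) ≠ 1) (hq0 : q ≠ 0)
    (hu : ∀ k : ℤ, u * q ^ k ≠ 1) (hu0 : u ≠ 0) (m n : ℤ) (j : ℕ) :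
    coeff j (bSeries q u m n) = bCoeff q m n u j := by
  rw [bSeries, coeff_mul,
    Finset.Nat.sum_antidiagonal_eq_sum_range_succ
      (fun a b => coeff a (fSeries q (u * q ^ (m - 1)) (q ^ n)) * coeff b (hSeries q (u / q) 1)),
    bCoeff, phiTrunc, Finset.mul_sum]
  refine Finset.sum_congr rfl fun k hk => ?_
  obtain ⟨l, rfl⟩ : ∃ l, j = l + k := ⟨j - k, by simp at hk; omega⟩
  have r1 := qPochNat_eq_mul_reflect (a := q) (b := q ^ (-((l + k : ℕ) : ℤ))) (q := q)
    (j := l + k) (by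
      rw [zpow_neg, zpow_natCast, mul_assoc, inv_mul_cancel₀ (pow_ne_zero _ hq0), mul_one])
      k (by omega)
  have r2 := qPochNat_eq_mul_reflect (a := q ^ 2 / u) (b := u * q ^ (-((l + k : ℕ) : ℤ) - 1)) (q := q)
    (j := l + k) (by
      rw [zpow_sub_one₀ hq0, zpow_neg, zpow_natCast]
      have := pow_ne_zero (l + k) hq0
      field_simp) k (by omega)
  rw [Nat.add_sub_cancel] at r1 r2 ⊢
  have d1 := qPochNat_self_ne_zero hq (l + k)
  have d2 := qPochNat_self_ne_zero hq l
  have d3 := qPochNat_self_ne_zero hq k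
  have hqu : ∀ i : ℕ, q ^ 2 / u * q ^ i ≠ 1 := fun i h => hu (-(i + 2 : ℕ)) (by
    rw [zpow_neg, zpow_natCast, pow_add, mul_comm (q ^ i), ← mul_inv_cancel₀ hu0]
    congr 1
    rw [inv_eq_iff_eq_inv, inv_inv, ← mul_one u, ← h]; field_simp)
  have d4 : qPochNat (q ^ 2 / u) q (l + k) ≠ 0 := qPochNat_ne_zero fun i _ => hqu i
  have d5 : qPochNat (q ^ 2 / u) q l ≠ 0 := qPochNat_ne_zero fun i _ => hqu i
  have d6 : qPochNat (u * q ^ m) q k ≠ 0 := qPochNat_ne_zero fun i _ => by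
    exact_mod_cast mul_zpow_mul_ne_one hq0 hu m i
  have e1 : u * q ^ (m - 1) * q = u * q ^ m := by
    rw [mul_assoc, ← zpow_add_one₀ hq0, sub_add_cancel]
  have e2 : (u / q)⁻¹ * q = q ^ 2 / u := by rw [inv_div]; ring
  have e3 : q ^ (((l + k : ℕ) : ℤ) + n + 1) = q ^ (l + k) * q ^ n * q := by
    rw [zpow_add_one₀ hq0, zpow_add₀ hq0, zpow_natCast]
  have key := congrArg (q ^ ·) (choose_two_add_identity l k)
  simp only [pow_add _ (_ : ℕ) (_ : ℕ)] at key
  simp only [fSeries, hSeries, coeff_mk, fCoeff, e1, e2, e3]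
  generalize qPochNat (q ^ (-((l + k : ℕ) : ℤ))) q k = P at *
  generalize qPochNat (u * q ^ (-((l + k : ℕ) : ℤ) - 1)) q k = R at *
  have hk1 : (-1 : ℂ) ^ k * (-1) ^ k = 1 := by rw [← mul_pow]; simp
  have s1 : P = qPochNat q q (l + k) * (q ^ (k.choose 2) * q ^ k) * (-1) ^ k /
      (qPochNat q q l * (q * q ^ (l + k)) ^ k) := by
    rw [r1]
    have := pow_ne_zero k (mul_ne_zero hq0 (pow_ne_zero (l + k) hq0))
    field_simp
    linear_combination (-P) * hk1
  have s2 : R = qPochNat (q ^ 2 / u) q (l + k) * (q ^ (k.choose 2) * q ^ k) * (-1) ^ k /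
      (qPochNat (q ^ 2 / u) q l * (q ^ 2 / u * q ^ (l + k)) ^ k) := by
    rw [r2]
    have := pow_ne_zero k (mul_ne_zero (div_ne_zero (pow_ne_zero 2 hq0) hu0)
      (pow_ne_zero (l + k) hq0))
    rw [eq_div_iff (mul_ne_zero d5 this)]
    linear_combination (-R * qPochNat (q ^ 2 / u) q l * (q ^ 2 / u * q ^ (l + k)) ^ k) * hk1
  rw [s1, s2, zpow_neg, zpow_natCast]
  generalize q ^ n = N at *
  generalize qPochNat (q ^ 2 / u) q (l + k) = Q1 at *
  generalize qPochNat (q ^ 2 / u) q l = Q2 at *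
  have e4 : (q / u) ^ l * u ^ (l + k) * (q ^ 2 * q ^ (l + k) / u) ^ k =
      q ^ l * q ^ (2 * k) * q ^ (l * k) * q ^ (k * k) := by
    rw [div_pow, div_pow]
    field_simp
    ring
  field_simp
  linear_combination N ^ k * (-1) ^ l * q ^ l.choose 2 * (q * q ^ (l + k)) ^ k * e4
    - (-1) ^ l * N ^ k * (q * q ^ (l + k)) ^ k * (q ^ k) ^ 2 * key
    - (-1) ^ l * q ^ k.choose 2 * q ^ (l + k + 1).choose 2 * (q ^ k) ^ 2 *
      (q * q ^ (l + k) * N) ^ k * hk1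

/-- Here `k` indexes `fSeries q (u / q) 1`, which supplies the denominator `(u; q)_k`. The prefactor
`(u/q; q)_m` splits into `(u/q; q)_(m-j)`, the numerator `(u q^(m-j-1); q)_k`, and a block of `l = j
- k` factors; reversed, that block cancels the denominator of the `hSeries` coefficient. -/
lemma coeff_aSeries {q u : ℂ} (hq : ∀ k : ℕ, q ^ (k + 1) ≠ 1) (hq0 : q ≠ 0)
    (hu : ∀ k : ℤ, u * q ^ k ≠ 1) (hu0 : u ≠ 0) (m n : ℤ) (j : ℕ) :
    coeff j (aSeries q u m n) = aCoeff q m n u j := by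
  rw [aSeries, coeff_C_mul, mul_comm (hSeries _ _ _), coeff_mul,
    Finset.Nat.sum_antidiagonal_eq_sum_range_succ
      (fun a b => coeff a (fSeries q (u / q) 1) * coeff b (hSeries q (u * q ^ (m - 1)) (q ^ n))),
    aCoeff, phiTrunc, Finset.mul_sum, Finset.mul_sum]
  refine Finset.sum_congr rfl fun k hk => ?_
  obtain ⟨l, rfl⟩ : ∃ l, j = l + k := ⟨j - k, by simp at hk; omega⟩
  have hu' := div_mul_ne_one hq0 hu
  have hv0 : u * q ^ (m - 1) ≠ 0 := mul_ne_zero hu0 (zpow_ne_zero _ hq0)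
  have r1 := qPochNat_eq_mul_reflect (a := q) (b := q ^ (-((l + k : ℕ) : ℤ))) (q := q)
    (j := l + k) (by
      rw [zpow_neg, zpow_natCast, mul_assoc, inv_mul_cancel₀ (pow_ne_zero _ hq0), mul_one])
      k (by omega)
  have r2 := qPochNat_eq_mul_reflect (a := (u * q ^ (m - 1))⁻¹ * q)
    (b := u / q * q ^ (m - l)) (q := q) (j := l) (by
      rw [sub_eq_add_neg, sub_eq_add_neg, zpow_add₀ hq0, zpow_add₀ hq0, zpow_neg_one, zpow_neg,
        zpow_natCast]
      have := zpow_ne_zero m hq0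
      field_simp) l le_rfl
  have r3 := qPoch_sub_mul hq0 hu' m l
  have r4 := qPoch_sub_mul hq0 hu' (m - l) k
  have e0 : u / q * q ^ (m - l - k) = u * q ^ (m - ((l + k : ℕ) : ℤ) - 1) := by
    rw [zpow_sub_one₀ hq0]; push_cast; rw [sub_sub]; ring
  have e0' : m - l - k = m - ((l + k : ℕ) : ℤ) := by push_cast; ring
  rw [e0, e0'] at r4
  rw [Nat.sub_self, qPochNat_zero, one_mul] at r2
  rw [Nat.add_sub_cancel] at r1 ⊢
  have d1 := qPochNat_self_ne_zero hq (l + k)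
  have d2 := qPochNat_self_ne_zero hq l
  have d3 := qPochNat_self_ne_zero hq k
  have d4 : qPochNat u q k ≠ 0 := qPochNat_ne_zero fun i _ => by exact_mod_cast hu i
  have d5 : qPochNat ((u * q ^ (m - 1))⁻¹ * q) q l ≠ 0 := qPochNat_ne_zero fun i _ => by
    have := inv_mul_zpow_ne_one (mul_zpow_mul_ne_one hq0 hu (m - 1)) (i + 1 : ℕ)
    rw [zpow_natCast, pow_succ'] at this
    rwa [mul_assoc]
  have e1 : q ^ ((((l + k : ℕ) : ℤ) - m + 1) * (n - 1) + 1) * (q ^ l * q ^ k) =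
      q ^ m * (q ^ (m - 1)) ^ (-n) * (q ^ n) ^ l * (q ^ n) ^ k := by
    simp only [← zpow_natCast, ← zpow_mul, ← zpow_add₀ hq0]
    congr 1; push_cast; ring
  have e2 : q ^ (((l + k : ℕ) : ℤ) - n + 1) = q ^ (l + k) / q ^ n * q := by
    rw [zpow_add_one₀ hq0, zpow_sub₀ hq0, zpow_natCast]
  have key := congrArg (q ^ ·) (two_mul_choose_two_add l)
  simp only [pow_add _ (_ : ℕ) (_ : ℕ)] at key
  simp only [fSeries, hSeries, coeff_mk, fCoeff, e2, div_mul_cancel₀ _ hq0, one_pow, mul_one]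
  generalize qPochNat (q ^ (-((l + k : ℕ) : ℤ))) q k = P at *
  rw [← r3, ← r4]
  generalize qPochNat (u * q ^ (m - ((l + k : ℕ) : ℤ) - 1)) q k = R at *
  have hk1 : (-1 : ℂ) ^ k * (-1) ^ k = 1 := by rw [← mul_pow]; simp
  have hl1 : (-1 : ℂ) ^ l * (-1) ^ l = 1 := by rw [← mul_pow]; simp
  have s1 : P = qPochNat q q (l + k) * (q ^ (k.choose 2) * q ^ k) * (-1) ^ k /
      (qPochNat q q l * (q * q ^ (l + k)) ^ k) := by
    rw [r1]
    have := pow_ne_zero k (mul_ne_zero hq0 (pow_ne_zero (l + k) hq0))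
    field_simp
    linear_combination (-P) * hk1
  have s3 : q ^ ((((l + k : ℕ) : ℤ) - m + 1) * (n - 1) + 1) =
      q ^ m * (q ^ (m - 1)) ^ (-n) * (q ^ n) ^ l * (q ^ n) ^ k / (q ^ l * q ^ k) := by
    rw [eq_div_iff (mul_ne_zero (pow_ne_zero _ hq0) (pow_ne_zero _ hq0)), e1]
  rw [s1, s3, mul_zpow]
  have hN := zpow_ne_zero n hq0
  generalize u * q ^ (m - 1) = v at *
  generalize q ^ n = N at *
  generalize qPochNat (v⁻¹ * q) q l = D at *
  have s2 : qPochNat (u / q * q ^ (m - l)) q l =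
      D * (q ^ l.choose 2 * q ^ l) * (-1) ^ l / (v⁻¹ * q * q ^ l) ^ l := by
    rw [r2]
    have := pow_ne_zero l (mul_ne_zero (mul_ne_zero (inv_ne_zero hv0) hq0) (pow_ne_zero l hq0))
    rw [eq_div_iff this]
    linear_combination (-(v⁻¹ * q * q ^ l) ^ l * qPochNat (u / q * q ^ (m - l)) q l) * hl1
  rw [s2]
  generalize qPoch (u / q) q (m - ((l + k : ℕ) : ℤ)) = S at *
  generalize (q ^ (m - 1)) ^ (-n) = T at *
  generalize q ^ m = M at *
  generalize u ^ (-n) = U at *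
  simp only [mul_pow, div_pow, inv_pow]
  field_simp
  linear_combination qPoch u q m * S * R * M * U * T * (((-1) ^ l) ^ 2 * key + q ^ (l * l) * hl1)

/-! ### The recurrence as an identity between power series -/

/-- The coefficient `A3` at an integer index, as a function of `u = q ^ ν`. -/
def aCoeffInt (q : ℂ) (m n : ℤ) (u : ℂ) (i : ℤ) : ℂ := if i < 0 then 0 else aCoeff q m n u i.toNat

/-- The coefficient `B3` at an integer index, as a function of `u = q ^ ν`. -/
def bCoeffInt (q : ℂ) (m n : ℤ) (u : ℂ) (i : ℤ) : ℂ := if i < 0 then 0 else bCoeff q m n u i.toNat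

/-- The polynomial `P3`, as a power series in `q (x / 2) ^ 2`. -/
def pSeries (q : ℂ) (m n : ℤ) (u : ℂ) : PowerSeries ℂ := PowerSeries.mk fun j =>
  if j < max n.natAbs (m - n).natAbs then
    aCoeffInt q m n u (j + min m 0) - bCoeffInt q m n u (j - max m 0) else 0

lemma coeff_X_pow_mul_eq_zcoeff (p : PowerSeries ℂ) (d j : ℕ) :
    coeff j (X ^ d * p) = zcoeff p (j - d) := by
  rw [coeff_X_pow_mul', zcoeff]
  by_cases h : d ≤ j
  · rw [if_pos h, if_neg (by omega)]; congr 2; omega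
  · rw [if_neg h, if_pos (by omega)]

/-- The truncation loses nothing, since `max (n - m) (-n) + max m 0 = max |n| |m - n|` is exactly
where the two products begin to agree. -/
lemma pSeries_eq {q u : ℂ} (hq : ∀ k : ℕ, q ^ (k + 1) ≠ 1) (hq0 : q ≠ 0)
    (hu : ∀ k : ℤ, u * q ^ k ≠ 1) (hu0 : u ≠ 0) (m n : ℤ) :
    pSeries q m n u =
      X ^ (-m).toNat * aSeries q u m n - X ^ m.toNat * bSeries q u m n := by
  have hA : ∀ i, aCoeffInt q m n u i = zcoeff (aSeries q u m n) i := fun i => by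
    rw [aCoeffInt, zcoeff, coeff_aSeries hq hq0 hu hu0]
  have hB : ∀ i, bCoeffInt q m n u i = zcoeff (bSeries q u m n) i := fun i => by
    rw [bCoeffInt, zcoeff, coeff_bSeries hq hq0 hu hu0]
  ext j
  have e1 : (j : ℤ) - (-m).toNat = j + min m 0 := by omega
  have e2 : (j : ℤ) - m.toNat = j - max m 0 := by omega
  rw [map_sub, coeff_X_pow_mul_eq_zcoeff, coeff_X_pow_mul_eq_zcoeff, e1, e2, pSeries, coeff_mk]
  split_ifs with h
  · rw [hA, hB]
  · have := zcoeff_aSeries_eq_zcoeff_bSeries hq hq0 hu hu0 m n (j - max m 0) (by omega)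
    rw [← this, show (j : ℤ) - max m 0 + m = j + min m 0 by omega, sub_self]

/-- The `aSeries` terms on the right cancel by the identity of constants `ek`; the `bSeries` terms
share the factor `fSeries q (u * q ^ m) (q ^ n)`, multiplied by the Wronskian. -/
lemma recurrence_generic {q u : ℂ} (hq : ∀ k : ℕ, q ^ (k + 1) ≠ 1) (hq0 : q ≠ 0)
    (hu : ∀ k : ℤ, u * q ^ k ≠ 1) (hu0 : u ≠ 0) (m n : ℤ) :
    X ^ (m + 1).toNat * fSeries q (u * q ^ m) (q ^ n) =
      C (1 / ((q - u) * (1 - u))) * (X * (pSeries q (m + 1) n u * fSeries q u 1))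
        - X ^ ((m + 1).toNat - m.toNat) * (pSeries q m n (u * q) * fSeries q (u / q) 1) := by
  have hu' := div_mul_ne_one hq0 hu
  have huq : ∀ k : ℤ, u * q * q ^ k ≠ 1 := by simpa using mul_zpow_mul_ne_one hq0 hu 1
  have w := wronskian hq hq0 hu hu0
  rw [pSeries_eq hq hq0 hu hu0, pSeries_eq hq hq0 huq (mul_ne_zero hu0 hq0),
    aSeries, bSeries, aSeries, bSeries]
  have e1 : u * q * q ^ (m - 1) = u * q ^ m := by
    rw [mul_assoc, ← zpow_one_add₀ hq0]; congr 2; ring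
  have n1 : 1 - u ≠ 0 := sub_ne_zero.2 (by simpa using (hu 0).symm)
  have n2 : q - u ≠ 0 := sub_ne_zero.2 fun h => hu (-1) (by
    rw [← h, zpow_neg_one, mul_inv_cancel₀ hq0])
  have s1 := qPoch_mul_shift hq0 hu m
  have s2 := qPoch_mul_shift hq0 hu' m
  rw [div_mul_cancel₀ _ hq0] at s2
  have ek : C (1 / ((q - u) * (1 - u))) * C (qPoch u q (m + 1) *
        (qPoch (u / q) q (m + 1) * q ^ (m + 1) * (u * q ^ m) ^ (-n))) =
      C (qPoch (u * q) q m * (qPoch u q m * q ^ m * (u * q ^ m) ^ (-n))) := by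
    rw [← map_mul, ← s1, ← s2, zpow_add_one₀ hq0]; congr 1; field_simp
  rw [e1, mul_div_cancel_right₀ _ hq0, add_sub_cancel_right]
  generalize C (qPoch u q (m + 1) *
        (qPoch (u / q) q (m + 1) * q ^ (m + 1) * (u * q ^ m) ^ (-n))) = K1 at *
  generalize C (qPoch (u * q) q m * (qPoch u q m * q ^ m * (u * q ^ m) ^ (-n))) = K2 at *
  generalize fSeries q (u * q ^ m) (q ^ n) = F at *
  generalize hSeries q (u * q ^ m) (q ^ n) = H at *
  rcases le_or_gt 0 m with hm | hm
  · lift m to ℕ using hm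
    rw [show (-((m : ℤ) + 1)).toNat = 0 by omega, show ((m : ℤ) + 1).toNat = m + 1 by omega,
      show (-(m : ℤ)).toNat = 0 by omega, show (m : ℤ).toNat = m by omega, Nat.add_sub_cancel_left]
    linear_combination (-X ^ (m + 1) * F) * w
      - X * H * fSeries q (u / q) 1 * fSeries q u 1 * ek
  · obtain ⟨k, rfl⟩ : ∃ k : ℕ, m = -((k + 1 : ℕ) : ℤ) := ⟨(-m - 1).toNat, by omega⟩
    rw [show (-(-((k + 1 : ℕ) : ℤ) + 1)).toNat = k by omega,
      show (-((k + 1 : ℕ) : ℤ) + 1).toNat = 0 by omega,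
      show (-(-((k + 1 : ℕ) : ℤ))).toNat = k + 1 by omega,
      show (-((k + 1 : ℕ) : ℤ)).toNat = 0 by omega]
    linear_combination (-F) * w
      - X ^ (k + 1) * H * fSeries q (u / q) 1 * fSeries q u 1 * ek

/-! ### Continuity of the coefficients -/

lemma continuous_qPochNat (q : ℂ) (j : ℕ) : Continuous fun a => qPochNat a q j :=
  continuous_finsetProd _ fun _ _ => by fun_prop

lemma continuousAt_qPoch {q a : ℂ} (hq0 : q ≠ 0) {m : ℤ}
    (h : ∀ k : ℤ, m ≤ k → k < 0 → a * q ^ k ≠ 1) : ContinuousAt (fun a => qPoch a q m) a := by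
  rcases le_total 0 m with hm | hm
  · lift m to ℕ using hm
    exact (continuous_qPochNat q m).continuousAt
  · obtain ⟨l, rfl⟩ : ∃ l : ℕ, m = -(l : ℤ) := ⟨(-m).toNat, by omega⟩
    simp only [qPoch_neg]
    refine continuousAt_const.div ?_ (qPochNat_ne_zero fun i hi => ?_)
    · exact ((continuous_qPochNat q l).comp (continuous_mul_const _)).continuousAt
    · rw [mul_assoc, ← zpow_natCast, ← zpow_add₀ hq0]
      exact h _ (by omega) (by omega)

lemma continuousAt_phiTrunc {q : ℂ} (hq : ∀ k : ℕ, q ^ (k + 1) ≠ 1) {b c : ℂ → ℂ} {u y : ℂ} {j : ℕ}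
    (hb : Continuous b) (hc : Continuous c) (h : ∀ i < j, c u * q ^ i ≠ 1) :
    ContinuousAt (fun u => phiTrunc (b u) (c u) q y j) u := by
  refine tendsto_finsetSum _ fun k hk => ?_
  refine ContinuousAt.mul (ContinuousAt.div ?_ ?_ (mul_ne_zero (qPochNat_self_ne_zero hq k)
    (qPochNat_ne_zero fun i hi => h i (by simp at hk; omega)))) continuousAt_const
  · exact continuousAt_const.mul ((continuous_qPochNat q k).comp hb).continuousAt
  · exact continuousAt_const.mul ((continuous_qPochNat q k).comp hc).continuousAt

lemma continuousAt_aCoeff {q u : ℂ} (hq : ∀ k : ℕ, q ^ (k + 1) ≠ 1) (hq0 : q ≠ 0) (hu0 : u ≠ 0)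
    {m n : ℤ} {j : ℕ} (hu : ∀ k : ℤ, k ≤ max (max 0 (-m)) (j - m + 1) → u * q ^ (-k) ≠ 1) :
    ContinuousAt (fun u => aCoeff q m n u j) u := by
  unfold aCoeff
  refine ((((continuousAt_qPoch hq0 fun k h1 h2 => ?_).mul ?_).div_const _).mul
    (continuousAt_const.mul (continuousAt_zpow₀ _ _ (Or.inl hu0)))).mul ?_
  · simpa using hu (-k) (by omega)
  · refine ContinuousAt.comp (f := fun u => u / q) (continuousAt_qPoch hq0 fun k h1 h2 => ?_)
      (continuous_id.div_const q).continuousAt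
    have := hu (-(k - 1)) (by omega)
    rw [neg_neg, zpow_sub_one₀ hq0] at this
    convert this using 1; ring
  · refine continuousAt_phiTrunc hq (continuous_mul_const _) continuous_id fun i hi => ?_
    simpa using hu (-i) (by omega)

lemma continuousAt_bCoeff {q u : ℂ} (hq : ∀ k : ℕ, q ^ (k + 1) ≠ 1) (hq0 : q ≠ 0) (hu0 : u ≠ 0)
    {m n : ℤ} {j : ℕ} (hu : ∀ k : ℤ, k ≤ max (-m) (j + 1) → u * q ^ (-k) ≠ 1) :
    ContinuousAt (fun u => bCoeff q m n u j) u := by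
  unfold bCoeff
  refine (((ContinuousAt.div continuousAt_const (continuousAt_const.mul ?_) ?_).mul
    continuousAt_const).mul
    (continuousAt_const.mul (continuousAt_zpow₀ _ _ (Or.inl hu0)))).mul ?_
  · exact ((continuous_qPochNat q j).continuousAt).comp (f := fun u => q ^ 2 / u)
      (continuousAt_const.div continuousAt_id hu0)
  · refine mul_ne_zero (qPochNat_self_ne_zero hq j) (qPochNat_ne_zero fun i hi h => ?_)
    refine hu (i + 2 : ℕ) (by push_cast; omega) ?_
    rw [zpow_neg, zpow_natCast, pow_add, ← div_eq_mul_inv,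
      div_eq_one_iff_eq (mul_ne_zero (pow_ne_zero _ hq0) (pow_ne_zero _ hq0))]
    rw [div_mul_eq_mul_div, div_eq_one_iff_eq hu0] at h
    rw [← h, mul_comm]
  · refine continuousAt_phiTrunc hq (continuous_mul_const _) (continuous_mul_const _) fun i hi => ?_
    rw [mul_assoc, ← zpow_natCast, ← zpow_add₀ hq0]
    simpa using hu (-(m + i)) (by omega)

/-- All coefficients of a family of power series are continuous at a point. -/
def CoeffContinuousAt (p : ℂ → PowerSeries ℂ) (u : ℂ) : Prop :=
  ∀ k, ContinuousAt (fun u => coeff k (p u)) u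

lemma CoeffContinuousAt.const (p : PowerSeries ℂ) (u : ℂ) : CoeffContinuousAt (fun _ => p) u :=
  fun _ => continuousAt_const

lemma CoeffContinuousAt.mul {p r : ℂ → PowerSeries ℂ} {u : ℂ} (hp : CoeffContinuousAt p u)
    (hr : CoeffContinuousAt r u) : CoeffContinuousAt (fun u => p u * r u) u := fun k => by
  simp only [coeff_mul]
  exact tendsto_finsetSum _ fun i _ => (hp i.1).mul (hr i.2)

lemma CoeffContinuousAt.sub {p r : ℂ → PowerSeries ℂ} {u : ℂ} (hp : CoeffContinuousAt p u)
    (hr : CoeffContinuousAt r u) : CoeffContinuousAt (fun u => p u - r u) u := fun k => by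
  simp only [map_sub]
  exact (hp k).sub (hr k)

lemma coeffContinuousAt_C {c : ℂ → ℂ} {u : ℂ} (hc : ContinuousAt c u) :
    CoeffContinuousAt (fun u => C (c u)) u := fun k => by
  simp only [coeff_C]
  split_ifs
  · exact hc
  · exact continuousAt_const

lemma coeffContinuousAt_fSeries {q u : ℂ} (hq : ∀ k : ℕ, q ^ (k + 1) ≠ 1) {v : ℂ → ℂ}
    (hv : Continuous v) (h : ∀ i : ℕ, v u * q * q ^ i ≠ 1) (s : ℂ) :
    CoeffContinuousAt (fun u => fSeries q (v u) s) u := fun k => by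
  simp only [fSeries, coeff_mk, fCoeff]
  refine ContinuousAt.mul (ContinuousAt.div continuousAt_const ?_ (mul_ne_zero
    (qPochNat_self_ne_zero hq k) (qPochNat_ne_zero fun i _ => h i))) continuousAt_const
  exact continuousAt_const.mul ((continuous_qPochNat q k).comp (hv.mul continuous_const)).continuousAt

/-- At the last summand, `i - m + 1` for the `A` index and `i + 1` for the `B` index both equal `max
(n - m) (-n)`. This is the source of that term in the excluded range of exponents. -/
lemma coeffContinuousAt_pSeries {q u : ℂ} (hq : ∀ k : ℕ, q ^ (k + 1) ≠ 1) (hq0 : q ≠ 0)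
    (hu0 : u ≠ 0) {m n : ℤ}
    (hu : ∀ k : ℤ, k ≤ max (max 1 (-m)) (max (n - m) (-n)) → u * q ^ (-k) ≠ 1) :
    CoeffContinuousAt (pSeries q m n) u := fun j => by
  simp only [pSeries, coeff_mk]
  split_ifs with h
  · refine ContinuousAt.sub ?_ ?_
    · unfold aCoeffInt
      split_ifs with h2
      · exact continuousAt_const
      · exact continuousAt_aCoeff hq hq0 hu0 fun k hk => hu k (by omega)
    · unfold bCoeffInt
      split_ifs with h2
      · exact continuousAt_const
      · exact continuousAt_bCoeff hq hq0 hu0 fun k hk => hu k (by omega)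
  · exact continuousAt_const

lemma dense_generic (q : ℂ) : Dense {u : ℂ | (∀ k : ℤ, u * q ^ k ≠ 1) ∧ u ≠ 0} := by
  have h : (insert 0 (Set.range fun k : ℤ => q ^ (-k))).Countable :=
    (Set.countable_range _).insert 0
  refine Dense.mono (fun u hu => ?_) (h.dense_compl ℝ)
  refine ⟨fun k hk => hu (Or.inr ⟨k, ?_⟩), fun h => hu (Or.inl h)⟩
  simp only [zpow_neg]
  exact (eq_inv_of_mul_eq_one_left hk).symm

/-- Coefficientwise, both sides are continuous at `u` and agree on the dense set of generic values.
-/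
lemma recurrence_series {q u : ℂ} (hq : ∀ k : ℕ, q ^ (k + 1) ≠ 1) (hq0 : q ≠ 0) (hu0 : u ≠ 0)
    (m n : ℤ) (hu : ∀ k : ℤ, k ≤ max (max 1 (-m - 1)) (max (n - m - 1) (-n)) →
      u * q ^ (-k) ≠ 1) :
    X ^ (m + 1).toNat * fSeries q (u * q ^ m) (q ^ n) =
      C (1 / ((q - u) * (1 - u))) * (X * (pSeries q (m + 1) n u * fSeries q u 1))
        - X ^ ((m + 1).toNat - m.toNat) * (pSeries q m n (u * q) * fSeries q (u / q) 1) := by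
  have n1 : 1 - u ≠ 0 := sub_ne_zero.2 (by simpa using (hu 0 (by omega)).symm)
  have n2 : q - u ≠ 0 := sub_ne_zero.2 fun h => hu 1 (by omega) (by
    rw [← h, zpow_neg_one, mul_inv_cancel₀ hq0])
  have cL : CoeffContinuousAt
      (fun u => X ^ (m + 1).toNat * fSeries q (u * q ^ m) (q ^ n)) u := by
    refine (CoeffContinuousAt.const _ _).mul
      (coeffContinuousAt_fSeries hq (continuous_mul_const _) (fun i => ?_) _)
    have := hu (-(m + 1 + i)) (by omega)
    rwa [neg_neg, zpow_add₀ hq0, zpow_add_one₀ hq0, zpow_natCast, ← mul_assoc, ← mul_assoc] at this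
  have cP : CoeffContinuousAt (fun u => pSeries q m n (u * q)) u := fun k => by
    refine ContinuousAt.comp (f := fun u => u * q)
      (coeffContinuousAt_pSeries hq hq0 (mul_ne_zero hu0 hq0) (fun k hk => ?_) k)
      (continuous_mul_const q).continuousAt
    have := hu (k - 1) (by omega)
    rwa [neg_sub, sub_eq_add_neg, zpow_one_add₀ hq0, ← mul_assoc] at this
  have cR : CoeffContinuousAt (fun u =>
      C (1 / ((q - u) * (1 - u))) * (X * (pSeries q (m + 1) n u * fSeries q u 1))
        - X ^ ((m + 1).toNat - m.toNat) * (pSeries q m n (u * q) * fSeries q (u / q) 1)) u := by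
    refine CoeffContinuousAt.sub ((coeffContinuousAt_C ?_).mul ((CoeffContinuousAt.const _ _).mul
      (CoeffContinuousAt.mul ?_ ?_)))
      ((CoeffContinuousAt.const _ _).mul (cP.mul ?_))
    · exact continuousAt_const.div (by fun_prop) (mul_ne_zero n2 n1)
    · exact coeffContinuousAt_pSeries hq hq0 hu0 fun k hk => hu k (by omega)
    · refine coeffContinuousAt_fSeries hq continuous_id (fun i => ?_) _
      have := hu (-(1 + i)) (by omega)
      rwa [neg_neg, zpow_one_add₀ hq0, zpow_natCast, ← mul_assoc] at this
    · refine coeffContinuousAt_fSeries hq (continuous_id.div_const q) (fun i => ?_) _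
      simpa [div_mul_cancel₀ _ hq0] using hu (-i) (by omega)
  ext k
  refine tendsto_nhds_unique_of_frequently_eq (cL k) (cR k) ?_
  refine (mem_closure_iff_frequently.1 (dense_generic q u)).mono fun v hv => ?_
  exact congrArg (coeff k) (recurrence_generic hq hq0 hv.1 hv.2 m n)

/-! ### Infinite `q`-shifted factorials -/

lemma summable_norm_mul_pow {q : ℂ} (hq : ‖q‖ < 1) (a : ℂ) : Summable fun j : ℕ => ‖-(a * q ^ j)‖ := by
  simp only [norm_neg, norm_mul, norm_pow]
  exact (summable_geometric_of_lt_one (norm_nonneg _) hq).mul_left _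

lemma qPochInf_eq_mul {q : ℂ} (hq : ‖q‖ < 1) (a : ℂ) (j : ℕ) :
    qPochInf a q = qPochNat a q j * qPochInf (a * q ^ j) q := by
  have h : Multipliable fun n : ℕ => 1 - a * q ^ (n + j) := by
    simpa [sub_eq_add_neg, pow_add, mul_assoc, mul_comm, mul_left_comm] using
      multipliable_one_add_of_summable (summable_norm_mul_pow hq (a * q ^ j))
  rw [qPochInf, ← Multipliable.prod_mul_tprod_nat_mul' (f := fun n : ℕ => 1 - a * q ^ n) h]
  simp only [qPochInf, qPochNat, pow_add, mul_assoc, mul_comm]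

lemma qPochInf_ne_zero {q a : ℂ} (hq : ‖q‖ < 1) (h : ∀ i : ℕ, a * q ^ i ≠ 1) : qPochInf a q ≠ 0 := by
  have := tprod_one_add_ne_zero_of_summable (f := fun j : ℕ => -(a * q ^ j))
    (fun i => by rw [← sub_eq_add_neg]; exact sub_ne_zero.2 (h i).symm) (summable_norm_mul_pow hq a)
  simpa [qPochInf, sub_eq_add_neg] using this

/-! ### Evaluating absolutely convergent power series -/

/-- The sum of a power series at `z`. -/
def seriesEval (p : PowerSeries ℂ) (z : ℂ) : ℂ := ∑' k, coeff k p * z ^ k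

/-- Absolute convergence of a power series at `z`. -/
def AbsConvAt (p : PowerSeries ℂ) (z : ℂ) : Prop := Summable fun k => ‖coeff k p * z ^ k‖

lemma coeff_mul_mul_pow (p r : PowerSeries ℂ) (z : ℂ) (k : ℕ) :
    coeff k (p * r) * z ^ k =
      ∑ ij ∈ Finset.HasAntidiagonal.antidiagonal k, coeff ij.1 p * z ^ ij.1 * (coeff ij.2 r * z ^ ij.2) := by
  rw [coeff_mul, Finset.sum_mul]
  refine Finset.sum_congr rfl fun ij h => ?_
  rw [← Finset.HasAntidiagonal.mem_antidiagonal.1 h, pow_add]; ring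

lemma AbsConvAt.mul {p r : PowerSeries ℂ} {z : ℂ} (hp : AbsConvAt p z) (hr : AbsConvAt r z) :
    AbsConvAt (p * r) z := by
  simp only [AbsConvAt, coeff_mul_mul_pow]
  exact summable_norm_sum_mul_antidiagonal_of_summable_norm
    (f := fun k => coeff k p * z ^ k) (g := fun k => coeff k r * z ^ k) hp hr

lemma seriesEval_mul {p r : PowerSeries ℂ} {z : ℂ} (hp : AbsConvAt p z) (hr : AbsConvAt r z) :
    seriesEval (p * r) z = seriesEval p z * seriesEval r z := by
  simp only [seriesEval, coeff_mul_mul_pow]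
  exact (tsum_mul_tsum_eq_tsum_sum_antidiagonal_of_summable_norm hp hr).symm

lemma seriesEval_sub {p r : PowerSeries ℂ} {z : ℂ} (hp : AbsConvAt p z) (hr : AbsConvAt r z) :
    seriesEval (p - r) z = seriesEval p z - seriesEval r z := by
  simp only [seriesEval, map_sub, sub_mul]
  exact hp.of_norm.tsum_sub hr.of_norm

lemma absConvAt_of_coeff_eq_zero {p : PowerSeries ℂ} (N : ℕ) (h : ∀ k, N ≤ k → coeff k p = 0)
    (z : ℂ) : AbsConvAt p z :=
  summable_of_ne_finset_zero (s := Finset.range N) fun k hk => by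
    rw [h k (by simpa using hk)]; simp

lemma seriesEval_of_coeff_eq_zero {p : PowerSeries ℂ} (N : ℕ) (h : ∀ k, N ≤ k → coeff k p = 0)
    (z : ℂ) : seriesEval p z = ∑ k ∈ Finset.range N, coeff k p * z ^ k :=
  tsum_eq_sum fun k hk => by rw [h k (by simpa using hk)]; simp

lemma coeff_X_pow_eq_zero (d k : ℕ) (h : d + 1 ≤ k) : coeff k (X ^ d : PowerSeries ℂ) = 0 := by
  rw [coeff_X_pow, if_neg (by omega)]

lemma absConvAt_X_pow (d : ℕ) (z : ℂ) : AbsConvAt (X ^ d) z :=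
  absConvAt_of_coeff_eq_zero (d + 1) (coeff_X_pow_eq_zero d) z

lemma seriesEval_X_pow (d : ℕ) (z : ℂ) : seriesEval (X ^ d) z = z ^ d := by
  rw [seriesEval_of_coeff_eq_zero (d + 1) (coeff_X_pow_eq_zero d)]
  simp [coeff_X_pow]

lemma coeff_C_eq_zero (c : ℂ) (k : ℕ) (h : 1 ≤ k) : coeff k (C c : PowerSeries ℂ) = 0 := by
  rw [coeff_C, if_neg (by omega)]

lemma absConvAt_C (c z : ℂ) : AbsConvAt (C c) z :=
  absConvAt_of_coeff_eq_zero 1 (coeff_C_eq_zero c) z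

lemma seriesEval_C (c z : ℂ) : seriesEval (C c) z = c := by
  rw [seriesEval_of_coeff_eq_zero 1 (coeff_C_eq_zero c)]; simp

lemma coeff_pSeries_eq_zero (q u : ℂ) (m n : ℤ) (k : ℕ) (h : max n.natAbs (m - n).natAbs ≤ k) :
    coeff k (pSeries q m n u) = 0 := by
  rw [pSeries, coeff_mk, if_neg (by omega)]

/-- Ratio test with limit 0, because the ratio contains `q^k`. Nonzero `s` and `z` keep the terms
nonzero, so that the ratios make sense. -/
lemma absConvAt_fSeries {q v s z : ℂ} (hq1 : ‖q‖ < 1) (hq0 : q ≠ 0) (hq : ∀ k : ℕ, q ^ (k + 1) ≠ 1)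
    (hv : ∀ i : ℕ, v * q * q ^ i ≠ 1) (hs : s ≠ 0) (hz : z ≠ 0) : AbsConvAt (fSeries q v s) z := by
  refine Summable.norm ?_
  have hne : ∀ k, fCoeff q v k ≠ 0 := fun k =>
    div_ne_zero (mul_ne_zero (pow_ne_zero _ (by norm_num)) (pow_ne_zero _ hq0))
      (mul_ne_zero (qPochNat_self_ne_zero hq k) (qPochNat_ne_zero fun i _ => hv i))
  have hne' : ∀ k, coeff k (fSeries q v s) * z ^ k ≠ 0 := fun k => by
    rw [fSeries, coeff_mk]
    exact mul_ne_zero (mul_ne_zero (hne k) (pow_ne_zero _ hs)) (pow_ne_zero _ hz)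
  have hr : ∀ k, coeff (k + 1) (fSeries q v s) * z ^ (k + 1) =
      -q ^ k / ((1 - q * q ^ k) * (1 - v * q * q ^ k)) * (s * z) *
        (coeff k (fSeries q v s) * z ^ k) := fun k => by
    have hc : (k + 1).choose 2 = k.choose 2 + k := by
      rw [Nat.choose_succ_succ' k 1, Nat.choose_one_right, add_comm]
    simp only [fSeries, coeff_mk, fCoeff, qPochNat_succ, hc, div_eq_mul_inv, mul_inv]
    ring
  have h0 : Tendsto (fun k : ℕ => q ^ k) atTop (𝓝 0) := tendsto_pow_atTop_nhds_zero_of_norm_lt_one hq1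
  have ht : Tendsto (fun k : ℕ => ‖-q ^ k / ((1 - q * q ^ k) * (1 - v * q * q ^ k)) * (s * z)‖)
      atTop (𝓝 ‖-(0 : ℂ) / ((1 - q * 0) * (1 - v * q * 0)) * (s * z)‖) :=
    ((h0.neg.div ((tendsto_const_nhds.sub (h0.const_mul q)).mul
      (tendsto_const_nhds.sub (h0.const_mul (v * q)))) (by simp)).mul_const _).norm
  refine summable_of_ratio_test_tendsto_lt_one (l := 0) one_pos (Eventually.of_forall hne') ?_
  simp only [neg_zero, zero_div, zero_mul, norm_zero] at ht
  refine ht.congr fun k => ?_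
  rw [hr, norm_mul _ (coeff k _ * _), mul_div_cancel_right₀ _ (norm_ne_zero_iff.2 (hne' k))]

lemma phi11_eq_seriesEval (q v s z : ℂ) :
    phi11 0 (v * q) q (s * z) = seriesEval (fSeries q v s) z := by
  refine tsum_congr fun k => ?_
  rw [fSeries, coeff_mk, fCoeff, qPochNat_zero_left, mul_pow]; ring

lemma A3_eq_aCoeffInt {q : ℝ} (hq : q ≠ 0) (m n : ℤ) (ν : ℂ) (i : ℤ) :
    A3 q m n ν i = aCoeffInt q m n ((q : ℂ) ^ ν) i := by
  rw [aCoeffInt]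
  split_ifs with h
  · rw [A3, if_pos h]
  · lift i to ℕ using not_lt.1 h
    rw [A3_natCast hq, Int.toNat_natCast]

lemma B3_eq_bCoeffInt {q : ℝ} (hq : q ≠ 0) (m n : ℤ) (ν : ℂ) (i : ℤ) :
    B3 q m n ν i = bCoeffInt q m n ((q : ℂ) ^ ν) i := by
  rw [bCoeffInt]
  split_ifs with h
  · rw [B3, if_pos h]
  · lift i to ℕ using not_lt.1 h
    rw [B3_natCast hq, Int.toNat_natCast]

lemma P3_eq_seriesEval {q : ℝ} (hq : q ≠ 0) (m n : ℤ) (ν x : ℂ) :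
    P3 q m n ν x = seriesEval (pSeries q m n ((q : ℂ) ^ ν)) (q * (x / 2) ^ 2) := by
  rw [seriesEval_of_coeff_eq_zero _ (coeff_pSeries_eq_zero (q : ℂ) _ m n), P3]
  refine Finset.sum_congr rfl fun j hj => ?_
  rw [pSeries, coeff_mk, if_pos (Finset.mem_range.1 hj), A3_eq_aCoeffInt hq, B3_eq_bCoeffInt hq,
    mul_pow, ← pow_mul]
  ring

/-! ### The three parts -/

/-- The form is manifest from the sum, whatever values the coefficients take. The strict inequality
with `0` forces the zero polynomial when `m = n = 0`. -/
lemma P3_eq_polynomial (q : ℝ) (m n : ℤ) (ν : ℂ) : ∃ p : Polynomial ℂ,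
    p.degree < ((max n.natAbs (m - n).natAbs : ℕ) : WithBot ℕ) ∧
      ∀ x : ℂ, P3 q m n ν x = p.eval (x ^ 2) := by
  refine ⟨∑ j ∈ Finset.range (max n.natAbs (m - n).natAbs),
    Polynomial.C ((1 / 4) ^ j * (q : ℂ) ^ j
      * (A3 q m n ν ((j : ℤ) + min m 0) - B3 q m n ν ((j : ℤ) - max m 0))) * Polynomial.X ^ j,
    ?_, fun x => ?_⟩
  · refine (Polynomial.degree_sum_le _ _).trans_lt ?_
    rw [Finset.sup_lt_iff (WithBot.bot_lt_coe _)]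
    intro j hj
    exact (Polynomial.degree_C_mul_X_pow_le _ _).trans_lt
      (by exact_mod_cast Finset.mem_range.1 hj)
  · rw [P3, Polynomial.eval_finsetSum]
    refine Finset.sum_congr rfl fun j _ => ?_
    rw [Polynomial.eval_mul, Polynomial.eval_C, Polynomial.eval_pow, Polynomial.eval_X, pow_mul,
      show (x / 2) ^ 2 = 1 / 4 * x ^ 2 by ring, mul_pow]
    ring

lemma recurrence_eval {q u : ℂ} (hq1 : ‖q‖ < 1) (hq : ∀ k : ℕ, q ^ (k + 1) ≠ 1) (hq0 : q ≠ 0)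
    (hu0 : u ≠ 0) (m n : ℤ) (hu : ∀ k : ℤ, k ≤ max (max 1 (-m - 1)) (max (n - m - 1) (-n)) →
      u * q ^ (-k) ≠ 1) {t : ℂ} (ht : t ≠ 0) :
    t ^ m * seriesEval (fSeries q (u * q ^ m) (q ^ n)) (q * t ^ 2) =
      1 / ((1 - u / q) * (1 - u)) * q ^ (-(max (m + 1) 0)) * t ^ (min (m + 2) (-m)) *
          seriesEval (pSeries q (m + 1) n u) (q * t ^ 2) * seriesEval (fSeries q u 1) (q * t ^ 2)
        - q ^ (-(max m 0)) * t ^ (min (m + 1) (1 - m) - 1) *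
          seriesEval (pSeries q m n (u * q)) (q * t ^ 2) *
          seriesEval (fSeries q (u / q) 1) (q * t ^ 2) := by
  have hz : q * t ^ 2 ≠ 0 := mul_ne_zero hq0 (pow_ne_zero 2 ht)
  have n1 : 1 - u ≠ 0 := sub_ne_zero.2 (by simpa using (hu 0 (by omega)).symm)
  have n2 : q - u ≠ 0 := sub_ne_zero.2 fun h => hu 1 (by omega) (by
    rw [← h, zpow_neg_one, mul_inv_cancel₀ hq0])
  have aL := absConvAt_fSeries (v := u * q ^ m) (s := q ^ n) hq1 hq0 hq (fun i => by
    have := hu (-(m + 1 + i)) (by omega)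
    rwa [neg_neg, zpow_add₀ hq0, zpow_add_one₀ hq0, zpow_natCast, ← mul_assoc, ← mul_assoc] at this)
    (zpow_ne_zero _ hq0) hz
  have aU := absConvAt_fSeries (v := u) (s := 1) hq1 hq0 hq (fun i => by
    have := hu (-(1 + i)) (by omega)
    rwa [neg_neg, zpow_one_add₀ hq0, zpow_natCast, ← mul_assoc] at this) one_ne_zero hz
  have aD := absConvAt_fSeries (v := u / q) (s := 1) hq1 hq0 hq (fun i => by
    simpa [div_mul_cancel₀ _ hq0] using hu (-i) (by omega)) one_ne_zero hz
  have aP : ∀ m n u, AbsConvAt (pSeries q m n u) (q * t ^ 2) := fun m n u =>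
    absConvAt_of_coeff_eq_zero _ (coeff_pSeries_eq_zero q u m n) _
  have key := congrArg (seriesEval · (q * t ^ 2)) (recurrence_series hq hq0 hu0 m n hu)
  have h1 : X = (X : PowerSeries ℂ) ^ 1 := (pow_one _).symm
  rw [h1, ← pow_mul, ← pow_mul, one_mul, one_mul] at key
  have aX := fun d => absConvAt_X_pow d (q * t ^ 2)
  rw [seriesEval_mul (aX _) aL, seriesEval_sub
    ((absConvAt_C _ _).mul ((aX _).mul ((aP _ _ _).mul aU))) ((aX _).mul ((aP _ _ _).mul aD)),
    seriesEval_mul (absConvAt_C _ _) ((aX _).mul ((aP _ _ _).mul aU)),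
    seriesEval_mul (aX _) ((aP _ _ _).mul aU), seriesEval_mul (aP _ _ _) aU,
    seriesEval_mul (aX _) ((aP _ _ _).mul aD), seriesEval_mul (aP _ _ _) aD,
    seriesEval_C, seriesEval_X_pow, seriesEval_X_pow, seriesEval_X_pow] at key
  generalize seriesEval (fSeries q (u * q ^ m) (q ^ n)) (q * t ^ 2) = E0 at *
  generalize seriesEval (pSeries q (m + 1) n u) (q * t ^ 2) = E1 at *
  generalize seriesEval (pSeries q m n (u * q)) (q * t ^ 2) = E2 at *
  generalize seriesEval (fSeries q u 1) (q * t ^ 2) = E3 at *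
  generalize seriesEval (fSeries q (u / q) 1) (q * t ^ 2) = E4 at *
  have ek : 1 / ((1 - u / q) * (1 - u)) = q * (1 / ((q - u) * (1 - u))) := by
    have : 1 - u / q = (q - u) / q := by field_simp
    rw [this]; field_simp
  rw [ek]
  generalize 1 / ((q - u) * (1 - u)) = K at *
  rcases le_or_gt 0 m with hm | hm
  · lift m to ℕ using hm
    rw [show ((m : ℤ) + 1).toNat = m + 1 by omega, show (m : ℤ).toNat = m by omega,
      Nat.add_sub_cancel_left] at key
    rw [show max ((m : ℤ) + 1) 0 = ((m + 1 : ℕ) : ℤ) by omega, show max (m : ℤ) 0 = m by omega,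
      show min ((m : ℤ) + 2) (-m) = -m by omega,
      show min ((m : ℤ) + 1) (1 - m) - 1 = -m by omega]
    simp only [zpow_neg, zpow_natCast]
    -- For `m ≥ 0` the formal identity carries `X^(m+1)` on the left; dividing it out yields the
    -- negative powers of `q` and `t`.
    refine mul_left_cancel₀ (pow_ne_zero (m + 1) hz) ?_
    rw [mul_left_comm, key]
    simp only [mul_pow]
    field_simp
    ring
  · obtain ⟨k, rfl⟩ : ∃ k : ℕ, m = -((k + 1 : ℕ) : ℤ) := ⟨(-m - 1).toNat, by omega⟩
    rw [show (-((k + 1 : ℕ) : ℤ) + 1).toNat = 0 by omega,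
      show (-((k + 1 : ℕ) : ℤ)).toNat = 0 by omega] at key
    rw [show max (-((k + 1 : ℕ) : ℤ) + 1) 0 = 0 by omega,
      show max (-((k + 1 : ℕ) : ℤ)) 0 = 0 by omega,
      show min (-((k + 1 : ℕ) : ℤ) + 2) (- -((k + 1 : ℕ) : ℤ)) = -((k + 1 : ℕ) : ℤ) + 2 by omega,
      show min (-((k + 1 : ℕ) : ℤ) + 1) (1 - -((k + 1 : ℕ) : ℤ)) - 1 = -((k + 1 : ℕ) : ℤ) by omega,
      zpow_add₀ ht]
    simp only [pow_zero, one_mul, pow_one] at key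
    rw [key]
    simp only [neg_zero, zpow_ofNat]
    ring

/-- Multiplication by the positive real `q^a` does not change the argument of `x`, so the principal
branch is multiplicative here. -/
lemma mul_cpow_scale {q : ℝ} (hq : 0 < q) {x : ℂ} (hx : x ≠ 0) (a : ℝ) (s : ℂ) :
    (x * (q : ℂ) ^ (a : ℂ)) ^ s = x ^ s * (q : ℂ) ^ (a * s) := by
  have hq' : (q : ℂ) ≠ 0 := by exact_mod_cast hq.ne'
  have hr : 0 < q ^ a := Real.rpow_pos_of_pos hq a
  have hr' : ((q ^ a : ℝ) : ℂ) ≠ 0 := by exact_mod_cast hr.ne'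
  rw [← Complex.ofReal_cpow hq.le, Complex.cpow_def_of_ne_zero (mul_ne_zero hx hr'),
    Complex.log_mul_ofReal _ hr _ hx, Real.log_rpow hq, Complex.cpow_def_of_ne_zero hx,
    Complex.cpow_def_of_ne_zero hq', ← Complex.exp_add, ← Complex.ofReal_log hq.le]
  congr 1; push_cast; ring

lemma J3_eq {q : ℝ} (hq : q ≠ 0) (ν x : ℂ) :
    J3 q ν x = qPochInf ((q : ℂ) ^ ν * q) q / qPochInf q q * (x / 2) ^ ν *
      seriesEval (fSeries q ((q : ℂ) ^ ν) 1) (q * (x / 2) ^ 2) := by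
  have hq' : (q : ℂ) ≠ 0 := by exact_mod_cast hq
  rw [J3, Complex.cpow_add _ _ hq', Complex.cpow_one, ← phi11_eq_seriesEval]
  congr 2; ring

lemma J3_scale_eq {q : ℝ} (hq : 0 < q) (ν : ℂ) (m n : ℤ) {x : ℂ} (hx : x ≠ 0) :
    (q : ℂ) ^ (-((ν + m) * n / 2)) * J3 q (ν + m) (x * (q : ℂ) ^ ((n : ℂ) / 2)) =
      qPochInf ((q : ℂ) ^ ν * (q : ℂ) ^ (m + 1)) q / qPochInf q q * (x / 2) ^ ν * ((x / 2) ^ m *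
        seriesEval (fSeries q ((q : ℂ) ^ ν * (q : ℂ) ^ m) ((q : ℂ) ^ n)) (q * (x / 2) ^ 2)) := by
  have hq' : (q : ℂ) ≠ 0 := by exact_mod_cast hq.ne'
  have hx2 : x / 2 ≠ 0 := div_ne_zero hx two_ne_zero
  have e1 : (x * (q : ℂ) ^ ((n : ℂ) / 2) / 2) ^ (ν + m) =
      (x / 2) ^ (ν + m) * (q : ℂ) ^ ((ν + m) * n / 2) := by
    have := mul_cpow_scale hq hx2 ((n : ℝ) / 2) (ν + m)
    push_cast at this
    rw [mul_div_right_comm, this]; congr 2; ring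
  have e2 : (q : ℂ) ^ (ν + m + 1) = (q : ℂ) ^ ν * (q : ℂ) ^ m * q := by
    rw [Complex.cpow_add _ _ hq', Complex.cpow_one, cpow_add_intCast hq']
  have e3 : ((q : ℂ) ^ ((n : ℂ) / 2)) ^ 2 = (q : ℂ) ^ n := by
    rw [← Complex.cpow_nat_mul, ← Complex.cpow_intCast]; congr 1; push_cast; ring
  have e4 : (x * (q : ℂ) ^ ((n : ℂ) / 2)) ^ 2 * q / 4 = (q : ℂ) ^ n * (q * (x / 2) ^ 2) := by
    rw [mul_pow, e3]; ring
  have e5 : (q : ℂ) ^ ((ν + m) * n / 2) ≠ 0 := by simp [Complex.cpow_eq_zero_iff, hq']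
  rw [J3, e1, e2, e4, phi11_eq_seriesEval, Complex.cpow_neg, cpow_add_intCast hx2,
    zpow_add_one₀ hq', mul_assoc ((q : ℂ) ^ ν)]
  field_simp

theorem J3_recurrence {q : ℝ} (hq0 : 0 < q) (hq1 : q < 1) (m n : ℤ) (ν : ℂ)
    (hν : ∀ k : ℤ, k ≤ max (max 1 (-m - 1)) (max (n - m - 1) (-n)) → (q : ℂ) ^ ν ≠ (q : ℂ) ^ k)
    {x : ℂ} (hx : x ≠ 0) :
    (q : ℂ) ^ (-((ν + m) * n / 2)) * J3 q (ν + m) (x * (q : ℂ) ^ ((n : ℂ) / 2)) =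
      R3 q m n ν x * J3 q ν x - R3 q (m - 1) n (ν + 1) x * J3 q (ν - 1) x := by
  have hq' : (q : ℂ) ≠ 0 := by exact_mod_cast hq0.ne'
  have hn : ‖(q : ℂ)‖ < 1 := by rwa [Complex.norm_real, Real.norm_of_nonneg hq0.le]
  have hqk : ∀ k : ℕ, (q : ℂ) ^ (k + 1) ≠ 1 := fun k => by
    exact_mod_cast (pow_lt_one₀ hq0.le hq1 k.succ_ne_zero).ne
  have hx2 : x / 2 ≠ 0 := div_ne_zero hx two_ne_zero
  have hu0 : (q : ℂ) ^ ν ≠ 0 := by simp [Complex.cpow_eq_zero_iff, hq']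
  have hu : ∀ k : ℤ, k ≤ max (max 1 (-m - 1)) (max (n - m - 1) (-n)) →
      (q : ℂ) ^ ν * (q : ℂ) ^ (-k) ≠ 1 := fun k hk h => hν k hk (by
    rw [zpow_neg, ← div_eq_mul_inv, div_eq_one_iff_eq (zpow_ne_zero _ hq')] at h; exact h)
  have e1 : (q : ℂ) ^ (ν + 1) = (q : ℂ) ^ ν * q := by
    rw [Complex.cpow_add _ _ hq', Complex.cpow_one]
  have e2 : (q : ℂ) ^ (ν - 1) = (q : ℂ) ^ ν / q := by
    rw [Complex.cpow_sub _ _ hq', Complex.cpow_one]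
  have e3 : (q : ℂ) ^ (ν + m + 1) = (q : ℂ) ^ ν * (q : ℂ) ^ (m + 1) := by
    rw [← cpow_add_intCast hq']; push_cast; rw [add_assoc]
  have e4 : ν + 1 + ((m - 1 : ℤ) : ℂ) + 1 = ν + m + 1 := by push_cast; ring
  have e5 : (x / 2) ^ (ν - 1) = (x / 2) ^ ν / (x / 2) := by
    rw [Complex.cpow_sub _ _ hx2, Complex.cpow_one]
  rw [J3_scale_eq hq0 ν m n hx, recurrence_eval hn hqk hq' hu0 m n hu hx2, R3, R3,
    P3_eq_seriesEval hq0.ne', P3_eq_seriesEval hq0.ne', J3_eq hq0.ne', J3_eq hq0.ne', e4, e3, e5,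
    add_sub_cancel_right, sub_add_cancel, e1, e2, div_mul_cancel₀ _ hq',
    show m - 1 + 2 = m + 1 by ring, show -(m - 1) = 1 - m by ring]
  rw [zpow_sub_one₀ hx2]
  generalize (q : ℂ) ^ ν = u at *
  have n1 : 1 - u ≠ 0 := sub_ne_zero.2 (by simpa using (hu 0 (by omega)).symm)
  have n2 : 1 - u / q ≠ 0 := sub_ne_zero.2 fun h => hu 1 (by omega) (by
    rw [zpow_neg_one]; exact h.symm)
  -- The ratio `(uq; q)_∞ / (u/q; q)_∞ = 1/((1-u/q)(1-u))` is the constant in `recurrence_eval`; in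
  -- the second product `(u; q)_∞` cancels entirely.
  have f1 := qPochInf_eq_mul hn u 1
  have f2 := qPochInf_eq_mul hn (u / q) 1
  simp only [qPochNat_succ, qPochNat_zero, pow_zero, pow_one, mul_one, one_mul] at f1 f2
  rw [div_mul_cancel₀ _ hq'] at f2
  have n3 : qPochInf (u * q) q ≠ 0 := qPochInf_ne_zero hn fun i => by
    have := hu (-(1 + i)) (by omega)
    rwa [neg_neg, zpow_one_add₀ hq', zpow_natCast, ← mul_assoc] at this
  rw [f2, f1]
  generalize (x / 2) ^ ν = T
  field_simp

theorem R3_zero_eq_qLommel {q : ℝ} (hq0 : 0 < q) (hq1 : q < 1) (m : ℕ) (ν : ℂ)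
    (hν : ∀ k : ℤ, k ≤ 1 → (q : ℂ) ^ ν ≠ (q : ℂ) ^ k) {x : ℂ} (hx : x ≠ 0) :
    R3 q m 0 ν (2 * x) = qLommel q m ν x := by
  have hq' : (q : ℂ) ≠ 0 := by exact_mod_cast hq0.ne'
  have hn : ‖(q : ℂ)‖ < 1 := by rwa [Complex.norm_real, Real.norm_of_nonneg hq0.le]
  have hqk : ∀ k : ℕ, (q : ℂ) ^ (k + 1) ≠ 1 := fun k => by
    exact_mod_cast (pow_lt_one₀ hq0.le hq1 k.succ_ne_zero).ne
  have hu : ∀ k : ℤ, -1 ≤ k → (q : ℂ) ^ ν * (q : ℂ) ^ k ≠ 1 := fun k hk h => hν (-k) (by omega) (by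
    rw [zpow_neg]; exact eq_inv_of_mul_eq_one_left h)
  rw [R3, P3, qLommel, Finset.mul_sum,
    show max (0 : ℤ).natAbs ((m : ℤ) + 1 - 0).natAbs = m + 1 by omega,
    show max ((m : ℤ) + 1) 0 = m + 1 by omega, show min ((m : ℤ) + 1) 0 = 0 by omega,
    show min ((m : ℤ) + 2) (-m) = -m by omega, mul_div_cancel_left₀ x two_ne_zero]
  refine Finset.sum_congr rfl fun j hj => ?_
  obtain ⟨l, rfl⟩ : ∃ l, m = j + l := ⟨m - j, by simp at hj; omega⟩
  -- For `n = 0` every summand has `j ≤ m`, so the index `j - (m + 1)` of `B` is negative.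
  have hB : B3 q (((j + l : ℕ) : ℤ) + 1) 0 ν ((j : ℤ) - (((j + l : ℕ) : ℤ) + 1)) = 0 := by
    rw [B3, if_pos (by push_cast; omega)]
  rw [hB, sub_zero, add_zero, A3, if_neg (by omega), cpow_intCast_sub hq', neg_zero, zpow_zero,
    mul_one, qPoch_natCast]
  have e1 : ((j + l : ℕ) : ℤ) + 1 = ((j + l + 1 : ℕ) : ℤ) := by push_cast; ring
  have e2 : ((j + l : ℕ) : ℤ) + 1 - j = ((l + 1 : ℕ) : ℤ) := by push_cast; ring
  have e3 : (q : ℂ) ^ (ν + (((j + l : ℕ) : ℤ) : ℂ) + 1) = (q : ℂ) ^ ν * (q : ℂ) ^ (j + l + 1) := by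
    rw [← zpow_natCast, ← cpow_add_intCast hq']; congr 1; push_cast; ring
  have e4 : (q : ℂ) ^ (ν - 1) = (q : ℂ) ^ ν / q := by
    rw [Complex.cpow_sub _ _ hq', Complex.cpow_one]
  have e5 : (q : ℂ) ^ (ν + ((j + l : ℕ) : ℂ) - j) = (q : ℂ) ^ ν * (q : ℂ) ^ l := by
    rw [← zpow_natCast, ← cpow_add_intCast hq']; congr 1; push_cast; ring
  have e6 : ν + (((((j + l : ℕ) : ℤ) + 1 : ℤ)) : ℂ) - ((j : ℤ) : ℂ) - 1 =
      ν + ((j + l : ℕ) : ℂ) - j := by push_cast; ring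
  have e7 : (q : ℂ) ^ ((j : ℤ) - 0 + 1) = (q : ℂ) ^ (j + 1) := by
    rw [← zpow_natCast]; congr 1
  have e8 : (q : ℂ) ^ (((j : ℤ) - (((j + l : ℕ) : ℤ) + 1) + 1) * (0 - 1) + 1) = (q : ℂ) ^ (l + 1) := by
    rw [← zpow_natCast]; congr 1; push_cast; ring
  have e9 : x ^ (2 * (j : ℤ) - ((j + l : ℕ) : ℤ)) = x ^ (2 * j) * x ^ (-((j + l : ℕ) : ℤ)) := by
    rw [sub_eq_add_neg, zpow_add₀ hx, ← zpow_natCast]; push_cast; rfl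
  rw [e6, e7, e8, e9, e2, e1, qPoch_natCast, qPoch_natCast, e3, e4, e5, zpow_neg, zpow_natCast]
  generalize phi21 _ _ _ _ _ = Φ
  generalize (q : ℂ) ^ ν = u at *
  have f1 := qPochInf_eq_mul hn u (j + l + 1)
  have f2 := qPochInf_eq_mul hn (u / q) (l + 1)
  have f3 := qPochInf_eq_mul hn (q : ℂ) j
  have e10 : u / q * (q : ℂ) ^ (l + 1) = u * (q : ℂ) ^ l := by rw [pow_succ]; field_simp
  rw [e10] at f2
  rw [← pow_succ'] at f3
  have n1 : qPochNat (u / q) q (l + 1) ≠ 0 := qPochNat_ne_zero fun i _ => by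
    have := hu (i - 1) (by omega)
    rw [zpow_sub_one₀ hq', zpow_natCast] at this
    convert this using 1; ring
  have n2 : qPochInf (u * (q : ℂ) ^ l) q ≠ 0 := qPochInf_ne_zero hn fun i => by
    have := hu (l + i) (by omega)
    rwa [zpow_add₀ hq', zpow_natCast, zpow_natCast, ← mul_assoc] at this
  have n3 := qPochNat_self_ne_zero hqk j
  have n4 : qPochInf ((q : ℂ) ^ (j + 1)) q ≠ 0 := qPochInf_ne_zero hn fun i => by
    rw [← pow_add, show j + 1 + i = j + i + 1 by ring]; exact hqk _
  rw [f1, f2, f3]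
  field_simp
  ring

end QBessel

end

/-- Three parts: the form and degree of `P^{(3)}`, the three-term recurrence relation, and the
case `n = 0`. The hypotheses on `ν` say that no denominator occurring in the asserted identity
vanishes, that is, that the series and the coefficients in it are defined. -/
theorem theorem4 (q : ℝ) (hq0 : 0 < q) (hq1 : q < 1) :
    (∀ (m n : ℤ) (ν : ℂ), ∃ p : Polynomial ℂ,
      p.degree < ((max n.natAbs (m - n).natAbs : ℕ) : WithBot ℕ) ∧
      ∀ x : ℂ, QBessel.P3 q m n ν x = p.eval (x ^ 2)) ∧
    (∀ (m n : ℤ) (ν : ℂ),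
      (∀ k : ℤ, k ≤ max (max 1 (-m - 1)) (max (n - m - 1) (-n)) →
        (q : ℂ) ^ ν ≠ (q : ℂ) ^ k) →
      ∀ x : ℂ, x ≠ 0 →
        (q : ℂ) ^ (-((ν + m) * n / 2)) * QBessel.J3 q (ν + m) (x * (q : ℂ) ^ ((n : ℂ) / 2)) =
          QBessel.R3 q m n ν x * QBessel.J3 q ν x
            - QBessel.R3 q (m - 1) n (ν + 1) x * QBessel.J3 q (ν - 1) x) ∧
    (∀ (m : ℕ) (ν : ℂ), 1 ≤ m →
      (∀ k : ℤ, k ≤ 1 → (q : ℂ) ^ ν ≠ (q : ℂ) ^ k) →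
      ∀ x : ℂ, x ≠ 0 → QBessel.R3 q m 0 ν (2 * x) = QBessel.qLommel q m ν x) := by
  exact ⟨QBessel.P3_eq_polynomial q,
    fun m n ν hν _ hx => QBessel.J3_recurrence hq0 hq1 m n ν hν hx,
    fun m ν _ hν _ hx => QBessel.R3_zero_eq_qLommel hq0 hq1 m ν hν hx⟩
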